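/- Let $k$ be a field, $G$ a finite set of letters, and $F$ a finite set of non-empty words in $G$. Let $A = k\langle G\rangle/(F)$, graded with the letters in degree one (a finitely presented connected graded monomial algebra). A word is called legal if it does not belong to the two-sided ideal $(F)$ of $k\langle G\rangle$. Let $\ell+1$ be the longest length of a word in $F$ (with $\ell=0$ if $F=\varnothing$). The Ufnarovskii graph of $A$ is the finite quiver $Q$ whose vertices are the legal words of length $\ell$ and whose arrows are the legal words $w$ of length $\ell+1$; if $w = sy = xt$ with letters $x,y$ and words $s,t$ of length $\ell$, then $w$ is an arrow from $s$ to $t$, labeled $x$. Let $kQ$ be the path algebra of $Q$ (the product $pq$ of paths is "first $p$, then $q$"), graded by path length. The algebra homomorphism $f : k\langle G\rangle \to kQ$ sending each letter $x$ to the sum of all arrows labeled $x$ vanishes on $(F)$ and so induces a homomorphism of graded algebras $\bar f : A \to kQ$, through which $kQ$ is viewed as a left $A$-module. For $R = A$ or $R = kQ$, let $\mathsf{Gr}\,R$ be the category of $\mathbb{Z}$-graded right $R$-modules with degree-preserving homomorphisms, $\mathsf{Fdim}\,R$ its full subcategory of modules that are the sum of their finite-dimensional submodules, $\mathsf{QGr}\,R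 = \mathsf{Gr}\,R/\mathsf{Fdim}\,R$ the quotient category, and $\pi_R : \mathsf{Gr}\,R \to \mathsf{QGr}\,R$ the quotient functor. Then $-\otimes_A kQ : \mathsf{Gr}\,A \to \mathsf{Gr}\,kQ$ induces an equivalence of categories $\mathsf{QGr}\,A \equiv \mathsf{QGr}\,kQ$; that is, there is an equivalence $\Phi : \mathsf{QGr}\,A \to \mathsf{QGr}\,kQ$ with $\Phi\circ\pi_A \cong \pi_{kQ}\circ(-\otimes_A kQ)$. -/

import Mathlib

open CategoryTheory

universe u v x

noncomputable section

/-! ### Graded right modules over an `ℕ`-graded algebra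

A right module over `A` is a module over the opposite ring `Aᵐᵒᵖ`; thus `m · a` is written
`MulOpposite.op a • m`. -/

/-- A `ℤ`-graded right module over the `ℕ`-graded `k`-algebra `A = ⨁ 𝒜 i`. -/
structure GrMod {k : Type u} {A : Type x} [Field k] [Ring A] [Algebra k A]
    (𝒜 : ℕ → Submodule k A) [GradedAlgebra 𝒜] where
  carrier : Type x
  [addCommGroup : AddCommGroup carrier]
  [moduleBase : Module k carrier]
  [moduleOp : Module Aᵐᵒᵖ carrier]
  [isScalarTower : IsScalarTower k Aᵐᵒᵖ carrier]
  /-- the homogeneous components -/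
  deg : ℤ → Submodule k carrier
  isInternal : DirectSum.IsInternal deg
  smul_mem : ∀ {i : ℤ} {j : ℕ} {m : carrier} {a : A}, m ∈ deg i → a ∈ 𝒜 j →
    MulOpposite.op a • m ∈ deg (i + j)

namespace GrMod

section Defs

variable {k : Type u} {A : Type x} [Field k] [Ring A] [Algebra k A]
  {𝒜 : ℕ → Submodule k A} [GradedAlgebra 𝒜]

instance : CoeSort (GrMod 𝒜) (Type x) := ⟨GrMod.carrier⟩

attribute [instance] addCommGroup moduleBase moduleOp isScalarTower

/-- A morphism of graded right modules: an `A`-linear map which preserves degrees. -/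
@[ext]
structure Hom (M N : GrMod 𝒜) where
  toLin : M →ₗ[Aᵐᵒᵖ] N
  map_deg : ∀ (i : ℤ) (m : M), m ∈ M.deg i → toLin m ∈ N.deg i

/-- The category `Gr A` of `ℤ`-graded right `A`-modules and degree-preserving homomorphisms. -/
instance : Category (GrMod 𝒜) where
  Hom := Hom
  id M := ⟨LinearMap.id, fun _ _ h => h⟩
  comp f g := ⟨g.toLin ∘ₗ f.toLin, fun i m h => g.map_deg i _ (f.map_deg i m h)⟩

@[simp] theorem id_toLin (M : GrMod 𝒜) : Hom.toLin (𝟙 M) = LinearMap.id := rfl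

@[simp] theorem comp_toLin {M N P : GrMod 𝒜} (f : M ⟶ N) (g : N ⟶ P) :
    Hom.toLin (f ≫ g) = (Hom.toLin g) ∘ₗ (Hom.toLin f) := rfl

@[ext] theorem hom_ext {M N : GrMod 𝒜} {f g : M ⟶ N} (h : Hom.toLin f = Hom.toLin g) : f = g :=
  Hom.ext h

/-- The projection of a graded module onto its component of degree `i`. -/
def proj (M : GrMod 𝒜) (i : ℤ) : M →ₗ[k] M :=
  letI := M.isInternal.chooseDecomposition
  (M.deg i).subtype ∘ₗ DirectSum.component k ℤ (fun i => M.deg i) i ∘ₗ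
    (DirectSum.decomposeLinearEquiv M.deg).toLinearMap

theorem proj_mem (M : GrMod 𝒜) (i : ℤ) (m : M) : M.proj i m ∈ M.deg i := by
  simp [proj]

theorem proj_same (M : GrMod 𝒜) {i : ℤ} {m : M} (h : m ∈ M.deg i) : M.proj i m = m := by
  let := M.isInternal.chooseDecomposition
  exact DirectSum.decompose_of_mem_same M.deg h

theorem proj_ne (M : GrMod 𝒜) {i j : ℤ} {m : M} (h : m ∈ M.deg j) (hij : j ≠ i) :
    M.proj i m = 0 := by
  let := M.isInternal.chooseDecomposition
  exact DirectSum.decompose_of_mem_ne M.deg h hij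

theorem iSup_deg (M : GrMod 𝒜) : ⨆ i, M.deg i = ⊤ :=
  M.isInternal.submodule_iSup_eq_top

theorem induction_deg (M : GrMod 𝒜) {p : M → Prop} (h0 : p 0)
    (hadd : ∀ a b, p a → p b → p (a + b)) (hom : ∀ i, ∀ m ∈ M.deg i, p m) (m : M) : p m :=
  Submodule.iSup_induction M.deg (motive := p) (by rw [M.iSup_deg]; trivial) hom h0 hadd

theorem proj_proj_ne (M : GrMod 𝒜) {i j : ℤ} (h : j ≠ i) (m : M) :
    M.proj i (M.proj j m) = 0 :=
  M.proj_ne (M.proj_mem j m) h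

theorem proj_smul (M : GrMod 𝒜) {j : ℕ} {a : A} (ha : a ∈ 𝒜 j) (i : ℤ) (m : M) :
    M.proj i (MulOpposite.op a • m) = MulOpposite.op a • M.proj (i - j) m := by
  induction m using M.induction_deg with
  | h0 => simp
  | hadd x y hx hy => simp only [smul_add, map_add, hx, hy]
  | hom l m hm =>
    by_cases hl : l + j = i
    · subst hl
      rw [M.proj_same (M.smul_mem hm ha), add_sub_cancel_right, M.proj_same hm]
    · rw [M.proj_ne (M.smul_mem hm ha) hl, M.proj_ne hm (by omega), smul_zero]

theorem Hom.map_proj {M N : GrMod 𝒜} (f : M ⟶ N) (i : ℤ) (m : M) :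
    Hom.toLin f (M.proj i m) = N.proj i (Hom.toLin f m) := by
  induction m using M.induction_deg with
  | h0 => simp
  | hadd x y hx hy => simp only [map_add, hx, hy]
  | hom l m hm =>
    by_cases hl : l = i
    · subst hl
      rw [M.proj_same hm, N.proj_same (Hom.map_deg f _ _ hm)]
    · rw [M.proj_ne hm hl, N.proj_ne (Hom.map_deg f _ _ hm) hl, map_zero]

/-- A criterion for a family of subspaces to be a grading. -/
theorem isInternal_of_proj {V : Type*} [AddCommGroup V] [Module k V] (d : ℤ → Submodule k V)
    (π : ℤ → V →ₗ[k] V) (h1 : ∀ i, ∀ m ∈ d i, π i m = m)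
    (h2 : ∀ i j, j ≠ i → ∀ m ∈ d j, π i m = 0) (h3 : ∀ m, m ∈ ⨆ i, d i) :
    DirectSum.IsInternal d := by
  rw [DirectSum.isInternal_submodule_iff_iSupIndep_and_iSup_eq_top]
  refine ⟨fun i => ?_, eq_top_iff.2 fun m _ => h3 m⟩
  rw [Submodule.disjoint_def]
  intro m hm hm'
  have : (⨆ j, ⨆ (_ : j ≠ i), d j) ≤ LinearMap.ker (π i) :=
    iSup₂_le fun j hj y hy => h2 i j hj y hy
  rw [← h1 i m hm]
  exact this hm'

/-- A graded submodule: one which contains the homogeneous components of its elements. -/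
def IsGradedSub (M : GrMod 𝒜) (K : Submodule Aᵐᵒᵖ M) : Prop :=
  ∀ m ∈ K, ∀ i, M.proj i m ∈ K

/-- A graded submodule as an object of `Gr A`. -/
def sub (M : GrMod 𝒜) (K : Submodule Aᵐᵒᵖ M) (hK : M.IsGradedSub K) : GrMod 𝒜 where
  carrier := K
  deg i := (M.deg i).comap (K.subtype.restrictScalars k)
  isInternal := by
    refine isInternal_of_proj _
      (fun i => (M.proj i).restrict (p := K.restrictScalars k) (q := K.restrictScalars k)
        (fun m hm => hK m hm i)) ?_ ?_ ?_
    · intro i m hm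
      exact Subtype.ext (M.proj_same hm)
    · intro i j hij m hm
      exact Subtype.ext (M.proj_ne hm hij)
    · intro m
      classical
      let := M.isInternal.chooseDecomposition
      have hm : m = ∑ i ∈ DFinsupp.support (DirectSum.decompose M.deg m.1),
          (⟨M.proj i m.1, hK _ m.2 i⟩ : K) := by
        apply Subtype.ext
        rw [AddSubmonoidClass.coe_finsetSum]
        exact (DirectSum.sum_support_decompose M.deg m.1).symm
      rw [hm]
      exact Submodule.sum_mem _ fun i _ => Submodule.mem_iSup_of_mem i (M.proj_mem i m.1)
  smul_mem h ha := M.smul_mem h ha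

/-- The quotient by a graded submodule as an object of `Gr A`. -/
def quot (M : GrMod 𝒜) (K : Submodule Aᵐᵒᵖ M) (hK : M.IsGradedSub K) : GrMod 𝒜 where
  carrier := M ⧸ K
  deg i := (M.deg i).map (K.mkQ.restrictScalars k)
  isInternal := by
    have hle : ∀ i, K.restrictScalars k ≤ (K.restrictScalars k).comap (M.proj i) :=
      fun i m hm => hK m hm i
    refine isInternal_of_proj _
      (fun i => Submodule.mapQ (K.restrictScalars k) (K.restrictScalars k) (M.proj i) (hle i))
      ?_ ?_ ?_
    · rintro i _ ⟨m, hm, rfl⟩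
      exact congrArg K.mkQ (M.proj_same hm)
    · rintro i j hij _ ⟨m, hm, rfl⟩
      exact (congrArg K.mkQ (M.proj_ne hm hij)).trans (map_zero K.mkQ)
    · intro m
      obtain ⟨m, rfl⟩ := K.mkQ_surjective m
      induction m using M.induction_deg with
      | h0 => rw [map_zero]; exact Submodule.zero_mem _
      | hadd x y hx hy => rw [map_add]; exact Submodule.add_mem _ hx hy
      | hom l m hm => exact Submodule.mem_iSup_of_mem l ⟨m, hm, rfl⟩
  smul_mem := by
    rintro i j _ a ⟨m, hm, rfl⟩ ha
    exact ⟨MulOpposite.op a • m, M.smul_mem hm ha, rfl⟩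

theorem isGradedSub_ker {M N : GrMod 𝒜} (f : M ⟶ N) :
    M.IsGradedSub (LinearMap.ker (Hom.toLin f)) := by
  intro m hm i
  rw [LinearMap.mem_ker] at hm ⊢
  rw [Hom.map_proj, hm, map_zero]

theorem isGradedSub_range {M N : GrMod 𝒜} (f : M ⟶ N) :
    N.IsGradedSub (LinearMap.range (Hom.toLin f)) := by
  rintro _ ⟨m, rfl⟩ i
  exact ⟨M.proj i m, Hom.map_proj f i m⟩

/-- The kernel of a morphism of graded modules. -/
def ker {M N : GrMod 𝒜} (f : M ⟶ N) : GrMod 𝒜 :=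
  M.sub (LinearMap.ker (Hom.toLin f)) (isGradedSub_ker f)

/-- The cokernel of a morphism of graded modules. -/
def coker {M N : GrMod 𝒜} (f : M ⟶ N) : GrMod 𝒜 :=
  N.quot (LinearMap.range (Hom.toLin f)) (isGradedSub_range f)

end Defs

/-! ### The categories `Fdim A` and `QGr A` -/

section QGr

variable {k : Type u} {A : Type x} [Field k] [Ring A] [Algebra k A]
  (𝒜 : ℕ → Submodule k A) [GradedAlgebra 𝒜]

/-- `Fdim A`: the graded modules which are the sum of their finite-dimensional (graded)
submodules. -/
def fdim : ObjectProperty (GrMod 𝒜) := fun M =>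
  sSup {K : Submodule Aᵐᵒᵖ M | M.IsGradedSub K ∧ FiniteDimensional k K} = ⊤

/-- The morphisms of `Gr A` whose kernel and cokernel belong to `Fdim A`. -/
def isoModFdim : MorphismProperty (GrMod 𝒜) := fun _ _ f =>
  fdim 𝒜 (ker f) ∧ fdim 𝒜 (coker f)

/-- The quotient category `QGr A = Gr A / Fdim A`: the localization of `Gr A` at the morphisms
whose kernel and cokernel belong to `Fdim A`. -/
abbrev QGr : Type _ := (isoModFdim 𝒜).Localization

/-- The quotient functor `Gr A ⥤ QGr A`. -/
abbrev toQGr : GrMod 𝒜 ⥤ QGr 𝒜 := (isoModFdim 𝒜).Q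

end QGr

/-! ### Extension of scalars -/

section Tensor

open TensorProduct

variable {k : Type u} {A B : Type x} [Field k] [Ring A] [Algebra k A] [Ring B] [Algebra k B]
  {𝒜 : ℕ → Submodule k A} [GradedAlgebra 𝒜] {ℬ : ℕ → Submodule k B}

/-- A submodule generated by elements all of whose components it contains is graded. -/
theorem isGradedSub_span (M : GrMod 𝒜) (S : Set M)
    (hS : ∀ s ∈ S, ∀ i, M.proj i s ∈ Submodule.span Aᵐᵒᵖ S) :
    M.IsGradedSub (Submodule.span Aᵐᵒᵖ S) := by
  intro m hm
  induction hm using Submodule.span_induction with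
  | mem s hs => exact hS s hs
  | zero => intro i; rw [map_zero]; exact Submodule.zero_mem _
  | add y z _ _ hy hz => intro i; rw [map_add]; exact Submodule.add_mem _ (hy i) (hz i)
  | smul b y _ hy =>
    obtain ⟨b, rfl⟩ := MulOpposite.op_surjective b
    intro i
    induction b using DirectSum.Decomposition.inductionOn 𝒜 with
    | zero => rw [MulOpposite.op_zero, zero_smul, map_zero]; exact Submodule.zero_mem _
    | @homogeneous j b =>
      rw [M.proj_smul b.2]
      exact Submodule.smul_mem _ _ (hy _)
    | add b c hb hc =>
      rw [MulOpposite.op_add, add_smul, map_add]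
      exact Submodule.add_mem _ hb hc

/-- The component of degree `n` of `M ⊗_k B`, spanned by the tensors of homogeneous elements whose
degrees add up to `n`. -/
def tensorDeg (M : GrMod 𝒜) (ℬ : ℕ → Submodule k B) (n : ℤ) : Submodule k (B ⊗[k] M) :=
  Submodule.span k {t | ∃ (i : ℤ) (j : ℕ) (m : M) (b : B),
    m ∈ M.deg i ∧ b ∈ ℬ j ∧ i + j = n ∧ t = b ⊗ₜ[k] m}

theorem tmul_mem_tensorDeg (M : GrMod 𝒜) {i : ℤ} {j : ℕ} {m : M} {b : B} (hm : m ∈ M.deg i)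
    (hb : b ∈ ℬ j) : b ⊗ₜ[k] m ∈ M.tensorDeg ℬ (i + j) :=
  Submodule.subset_span ⟨i, j, m, b, hm, hb, rfl, rfl⟩

theorem tensor_induction (M : GrMod 𝒜) (ℬ : ℕ → Submodule k B) [GradedAlgebra ℬ]
    {p : B → M → Prop}
    (hl0 : ∀ m, p 0 m) (hr0 : ∀ b, p b 0)
    (hl : ∀ b c m, p b m → p c m → p (b + c) m) (hr : ∀ b m n, p b m → p b n → p b (m + n))
    (h : ∀ (i : ℤ) (j : ℕ), ∀ m ∈ M.deg i, ∀ b ∈ ℬ j, p b m) (b : B) (m : M) : p b m := by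
  induction b using DirectSum.Decomposition.inductionOn ℬ with
  | zero => exact hl0 m
  | @homogeneous j b =>
    induction m using M.induction_deg with
    | h0 => exact hr0 _
    | hadd y z hy hz => exact hr _ _ _ hy hz
    | hom i m hm => exact h i j m hm b b.2
  | add b c hb hc => exact hl _ _ _ hb hc

/-- The map `φ ⊗ 1 : M ⊗_k B → N ⊗_k B`. -/
def tensorBaseMap (B : Type x) [Ring B] [Algebra k B] {M N : GrMod 𝒜} (φ : M ⟶ N) :
    B ⊗[k] M →ₗ[Bᵐᵒᵖ] B ⊗[k] N :=
  TensorProduct.AlgebraTensorModule.map (LinearMap.id : B →ₗ[Bᵐᵒᵖ] B)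
    ((Hom.toLin φ).restrictScalars k)

theorem tensorBaseMap_tmul {M N : GrMod 𝒜} (φ : M ⟶ N) (b : B) (m : M) :
    tensorBaseMap B φ (b ⊗ₜ[k] m) = b ⊗ₜ[k] Hom.toLin φ m := rfl

theorem tensorBaseMap_mem {M N : GrMod 𝒜} (φ : M ⟶ N) {n : ℤ} (t : B ⊗[k] M)
    (ht : t ∈ M.tensorDeg ℬ n) : tensorBaseMap B φ t ∈ N.tensorDeg ℬ n := by
  induction ht using Submodule.span_induction with
  | mem t ht =>
    obtain ⟨i, j, m, b, hm, hb, hn, rfl⟩ := ht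
    exact Submodule.subset_span ⟨i, j, Hom.toLin φ m, b, Hom.map_deg φ i m hm, hb, hn, rfl⟩
  | zero => rw [map_zero]; exact Submodule.zero_mem _
  | add y z _ _ hy hz => rw [map_add]; exact Submodule.add_mem _ hy hz
  | smul c y _ hy =>
    rw [LinearMap.map_smul_of_tower]
    exact Submodule.smul_mem _ _ hy

/-- The projection of `M ⊗_k B` onto its component of degree `n`. -/
def tensorProj (M : GrMod 𝒜) (ℬ : ℕ → Submodule k B) [GradedAlgebra ℬ] (n : ℤ) :
    B ⊗[k] M →ₗ[k] B ⊗[k] M :=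
  TensorProduct.lift
    (DirectSum.toModule k ℕ (M →ₗ[k] B ⊗[k] M) (fun j =>
        ((TensorProduct.mk k B M).compl₂ (M.proj (n - j))) ∘ₗ (ℬ j).subtype) ∘ₗ
      (DirectSum.decomposeLinearEquiv ℬ).toLinearMap)

variable [GradedAlgebra ℬ]

theorem tensorProj_tmul (M : GrMod 𝒜) (n : ℤ) {j : ℕ} {b : B} (hb : b ∈ ℬ j) (m : M) :
    M.tensorProj ℬ n (b ⊗ₜ[k] m) = b ⊗ₜ[k] M.proj (n - j) m := by
  lift b to ℬ j using hb
  simp [tensorProj]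

/-- The graded right `B`-module `M ⊗_k B`. The underlying vector space is written with the factor
`B` on the left, so that Mathlib's action of `Bᵐᵒᵖ` on the left factor gives
`(m ⊗ b') · b = m ⊗ (b' b)`. -/
def tensorBase (M : GrMod 𝒜) (ℬ : ℕ → Submodule k B) [GradedAlgebra ℬ] : GrMod ℬ where
  carrier := B ⊗[k] M
  deg := M.tensorDeg ℬ
  isInternal := by
    refine isInternal_of_proj _ (M.tensorProj ℬ) ?_ ?_ ?_
    · intro n t ht
      induction ht using Submodule.span_induction with
      | mem t ht =>
        obtain ⟨i, j, m, b, hm, hb, rfl, rfl⟩ := ht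
        rw [tensorProj_tmul M _ hb, add_sub_cancel_right, M.proj_same hm]
      | zero => rw [map_zero]
      | add y z _ _ hy hz => rw [map_add, hy, hz]
      | smul c y _ hy => rw [map_smul, hy]
    · intro n n' hn t ht
      induction ht using Submodule.span_induction with
      | mem t ht =>
        obtain ⟨i, j, m, b, hm, hb, rfl, rfl⟩ := ht
        rw [tensorProj_tmul M _ hb, M.proj_ne hm (by omega), TensorProduct.tmul_zero]
      | zero => rw [map_zero]
      | add y z _ _ hy hz => rw [map_add, hy, hz, add_zero]
      | smul c y _ hy => rw [map_smul, hy, smul_zero]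
    · intro t
      induction t using TensorProduct.induction_on with
      | zero => exact Submodule.zero_mem _
      | add y z hy hz => exact Submodule.add_mem _ hy hz
      | tmul b m =>
        refine M.tensor_induction ℬ (p := fun b m => b ⊗ₜ[k] m ∈ ⨆ i, M.tensorDeg ℬ i)
          ?_ ?_ ?_ ?_ ?_ b m
        · intro m; rw [TensorProduct.zero_tmul]; exact Submodule.zero_mem _
        · intro m; rw [TensorProduct.tmul_zero]; exact Submodule.zero_mem _
        · intro b c m hb hc; rw [TensorProduct.add_tmul]; exact Submodule.add_mem _ hb hc
        · intro b c m hb hc; rw [TensorProduct.tmul_add]; exact Submodule.add_mem _ hb hc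
        · intro i j m hm b hb
          exact Submodule.mem_iSup_of_mem _ (M.tmul_mem_tensorDeg hm hb)
  smul_mem := by
    intro n l t c ht hc
    induction ht using Submodule.span_induction with
    | mem t ht =>
      obtain ⟨i, j, m, b, hm, hb, rfl, rfl⟩ := ht
      rw [TensorProduct.smul_tmul']
      have := M.tmul_mem_tensorDeg hm (SetLike.mul_mem_graded hb hc)
      rw [Nat.cast_add, ← add_assoc] at this
      exact this
    | zero => rw [smul_zero]; exact Submodule.zero_mem _
    | add y z _ _ hy hz => rw [smul_add]; exact Submodule.add_mem _ hy hz
    | smul c y _ hy => rw [smul_comm]; exact Submodule.smul_mem _ _ hy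

variable (f : A →ₐ[k] B)

/-- The relations `m a ⊗ b = m ⊗ f(a) b` which define `M ⊗_A B` as a quotient of `M ⊗_k B`. -/
def tensorRel (M : GrMod 𝒜) : Set (B ⊗[k] M) :=
  {t | ∃ (m : M) (a : A) (b : B), t = b ⊗ₜ[k] (MulOpposite.op a • m) - (f a * b) ⊗ₜ[k] m}

theorem isGradedSub_tensorRel (hf : ∀ i, ∀ a ∈ 𝒜 i, f a ∈ ℬ i) (M : GrMod 𝒜) :
    (M.tensorBase ℬ).IsGradedSub
      (Submodule.span Bᵐᵒᵖ (tensorRel f M : Set (M.tensorBase ℬ).carrier)) := by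
  set K := Submodule.span Bᵐᵒᵖ (tensorRel f M : Set (M.tensorBase ℬ).carrier) with hKdef
  apply isGradedSub_span
  rintro _ ⟨m, a, b, rfl⟩ n
  induction a using DirectSum.Decomposition.inductionOn 𝒜 with
  | zero =>
    have : b ⊗ₜ[k] (MulOpposite.op (0 : A) • m) - (f 0 * b) ⊗ₜ[k] m = 0 := by simp
    rw [this]
    erw [map_zero]
    exact Submodule.zero_mem _
  | add a a' ha ha' =>
    have : b ⊗ₜ[k] (MulOpposite.op (a + a') • m) - (f (a + a') * b) ⊗ₜ[k] m =
      (b ⊗ₜ[k] (MulOpposite.op a • m) - (f a * b) ⊗ₜ[k] m) +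
      (b ⊗ₜ[k] (MulOpposite.op a' • m) - (f a' * b) ⊗ₜ[k] m) := by
      rw [MulOpposite.op_add, add_smul, TensorProduct.tmul_add, map_add, add_mul,
        TensorProduct.add_tmul]
      abel
    rw [this]
    erw [map_add]
    exact Submodule.add_mem _ ha ha'
  | @homogeneous l a =>
    refine M.tensor_induction ℬ (p := fun b m => (M.tensorBase ℬ).proj n
      (b ⊗ₜ[k] (MulOpposite.op a.1 • m) - (f a.1 * b) ⊗ₜ[k] m) ∈ K) ?_ ?_ ?_ ?_ ?_ b m
    · intro m
      have : (0 : B) ⊗ₜ[k] (MulOpposite.op a.1 • m) - (f a.1 * 0) ⊗ₜ[k] m = 0 := by simp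
      rw [this]
      erw [map_zero]
      exact Submodule.zero_mem _
    · intro b
      have : b ⊗ₜ[k] (MulOpposite.op a.1 • (0 : M)) - (f a.1 * b) ⊗ₜ[k] (0 : M) = 0 := by simp
      rw [this]
      erw [map_zero]
      exact Submodule.zero_mem _
    · intro b c m hb hc
      have : (b + c) ⊗ₜ[k] (MulOpposite.op a.1 • m) - (f a.1 * (b + c)) ⊗ₜ[k] m =
        (b ⊗ₜ[k] (MulOpposite.op a.1 • m) - (f a.1 * b) ⊗ₜ[k] m) +
        (c ⊗ₜ[k] (MulOpposite.op a.1 • m) - (f a.1 * c) ⊗ₜ[k] m) := by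
        rw [mul_add, TensorProduct.add_tmul, TensorProduct.add_tmul]
        abel
      rw [this]
      erw [map_add]
      exact Submodule.add_mem _ hb hc
    · intro b m m' hb hc
      have : b ⊗ₜ[k] (MulOpposite.op a.1 • (m + m')) - (f a.1 * b) ⊗ₜ[k] (m + m') =
        (b ⊗ₜ[k] (MulOpposite.op a.1 • m) - (f a.1 * b) ⊗ₜ[k] m) +
        (b ⊗ₜ[k] (MulOpposite.op a.1 • m') - (f a.1 * b) ⊗ₜ[k] m') := by
        rw [smul_add, TensorProduct.tmul_add, TensorProduct.tmul_add]
        abel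
      rw [this]
      erw [map_add]
      exact Submodule.add_mem _ hb hc
    · intro i j m hm b hb
      have h1 := M.tmul_mem_tensorDeg (M.smul_mem hm a.2) hb
      have h2 := M.tmul_mem_tensorDeg hm (SetLike.mul_mem_graded (hf l _ a.2) hb)
      rw [Nat.cast_add, ← add_assoc] at h2
      have h3 : b ⊗ₜ[k] (MulOpposite.op a.1 • m) - (f a.1 * b) ⊗ₜ[k] m ∈
        (M.tensorBase ℬ).deg (i + l + j) := Submodule.sub_mem _ h1 h2
      by_cases hn : i + l + j = n
      · subst hn
        rw [(M.tensorBase ℬ).proj_same h3]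
        exact Submodule.subset_span ⟨m, a.1, b, rfl⟩
      · rw [(M.tensorBase ℬ).proj_ne h3 hn]
        exact Submodule.zero_mem _

/-- The graded right `B`-module `M ⊗_A B`, where `B` is viewed as a left `A`-module through the
graded homomorphism `f : A → B`. -/
def tensorObj (hf : ∀ i, ∀ a ∈ 𝒜 i, f a ∈ ℬ i) (M : GrMod 𝒜) : GrMod ℬ :=
  (M.tensorBase ℬ).quot
    (Submodule.span Bᵐᵒᵖ (tensorRel f M : Set (M.tensorBase ℬ).carrier))
    (isGradedSub_tensorRel f hf M)

theorem tensorRel_le {M N : GrMod 𝒜} (φ : M ⟶ N) :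
    Submodule.span Bᵐᵒᵖ (tensorRel f M) ≤
      (Submodule.span Bᵐᵒᵖ (tensorRel f N)).comap (tensorBaseMap B φ) := by
  rw [Submodule.span_le]
  rintro _ ⟨m, a, b, rfl⟩
  refine Submodule.subset_span ⟨Hom.toLin φ m, a, b, ?_⟩
  rw [map_sub, tensorBaseMap_tmul, tensorBaseMap_tmul, map_smul]

/-- The functor `- ⊗_A B : Gr A ⥤ Gr B`, sending `φ` to the map `m ⊗ b ↦ φ(m) ⊗ b`. -/
def tensorFunctor (hf : ∀ i, ∀ a ∈ 𝒜 i, f a ∈ ℬ i) : GrMod 𝒜 ⥤ GrMod ℬ where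
  obj M := tensorObj f hf M
  map {M N} φ :=
    { toLin := Submodule.mapQ _ _ (tensorBaseMap B φ) (tensorRel_le f φ)
      map_deg := by
        rintro n _ ⟨t, ht, rfl⟩
        exact ⟨tensorBaseMap B φ t, tensorBaseMap_mem φ t ht, rfl⟩ }
  map_id M := by
    apply Hom.ext
    apply Submodule.linearMap_qext
    apply TensorProduct.AlgebraTensorModule.ext
    intro b m
    rfl
  map_comp φ ψ := by
    apply Hom.ext
    apply Submodule.linearMap_qext
    apply TensorProduct.AlgebraTensorModule.ext
    intro b m
    rfl

end Tensor

end GrMod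

/-! ### The path algebra of a quiver -/

/-- The finite paths of a quiver, including the trivial paths. -/
abbrev QPath (V : Type v) [Quiver.{v} V] : Type v := Σ a b : V, Quiver.Path a b

/-- The vector space underlying the path algebra `kQ`: its basis consists of the finite paths. -/
def PathAlgebra (k : Type u) (V : Type v) [Field k] [Quiver.{v} V] : Type (max u v) :=
  QPath V →₀ k

namespace PathAlgebra

variable {k : Type u} {V : Type v} [Field k] [Quiver.{v} V]

instance : AddCommGroup (PathAlgebra k V) := inferInstanceAs (AddCommGroup (QPath V →₀ k))

instance : Module k (PathAlgebra k V) := inferInstanceAs (Module k (QPath V →₀ k))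

/-- The basis element of `kQ` given by a path. -/
def ofPath (k : Type u) [Field k] (p : QPath V) : PathAlgebra k V := Finsupp.single p (1 : k)

/-- The linear map on `kQ` with prescribed values on the basis of paths. -/
def liftPath {W : Type*} [AddCommGroup W] [Module k W] (g : QPath V → W) :
    PathAlgebra k V →ₗ[k] W :=
  Finsupp.lift W k (QPath V) g

theorem liftPath_ofPath {W : Type*} [AddCommGroup W] [Module k W] (g : QPath V → W)
    (p : QPath V) : liftPath g (ofPath k p) = g p := by
  change Finsupp.sum (Finsupp.single p (1 : k)) (fun p c => c • g p) = g p
  rw [Finsupp.sum_single_index (h := fun p c => c • g p) (zero_smul k _), one_smul]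

theorem linearMap_ext {W : Type*} [AddCommGroup W] [Module k W] {f g : PathAlgebra k V →ₗ[k] W}
    (h : ∀ p, f (ofPath k p) = g (ofPath k p)) : f = g :=
  Finsupp.lhom_ext' fun p => LinearMap.ext_ring (h p)

open Classical in
/-- The product `pq` of two paths: the concatenation "first `p`, then `q`" if `p` ends where `q`
begins, and zero otherwise. -/
def pathMul (k : Type u) [Field k] (p q : QPath V) : PathAlgebra k V :=
  if h : q.1 = p.2.1 then ofPath k ⟨p.1, q.2.1, p.2.2.comp (q.2.2.cast h rfl)⟩ else 0

/-- The multiplication of `kQ`, as a bilinear map. -/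
def mulLin : PathAlgebra k V →ₗ[k] PathAlgebra k V →ₗ[k] PathAlgebra k V :=
  liftPath fun p => liftPath fun q => pathMul k p q

instance : Mul (PathAlgebra k V) := ⟨fun a b => mulLin a b⟩

theorem mul_def (a b : PathAlgebra k V) : a * b = mulLin a b := rfl

theorem ofPath_mul (p q : QPath V) : ofPath k p * ofPath k q = pathMul k p q := by
  rw [mul_def, mulLin, liftPath_ofPath, liftPath_ofPath]

theorem ofPath_mul_comp {a b c : V} (p : Quiver.Path a b) (q : Quiver.Path b c) :
    ofPath k ⟨a, b, p⟩ * ofPath k ⟨b, c, q⟩ = ofPath k ⟨a, c, p.comp q⟩ := by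
  rw [ofPath_mul, pathMul, dif_pos rfl, Quiver.Path.cast_rfl_rfl]

theorem ofPath_mul_ne {p q : QPath V} (h : q.1 ≠ p.2.1) : ofPath k p * ofPath k q = 0 := by
  rw [ofPath_mul, pathMul, dif_neg h]

theorem ofPath_mul_assoc (p q r : QPath V) :
    ofPath k p * ofPath k q * ofPath k r = ofPath k p * (ofPath k q * ofPath k r) := by
  obtain ⟨a, b, p⟩ := p
  obtain ⟨b', c, q⟩ := q
  obtain ⟨c', d, r⟩ := r
  by_cases h : b' = b
  · subst h
    by_cases h' : c' = c
    · subst h'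
      simp only [ofPath_mul_comp, Quiver.Path.comp_assoc]
    · rw [ofPath_mul_comp, ofPath_mul_ne h', ofPath_mul_ne h', mul_def, map_zero]
  · rw [ofPath_mul_ne h, mul_def 0, map_zero, LinearMap.zero_apply]
    by_cases h' : c' = c
    · subst h'
      rw [ofPath_mul_comp, ofPath_mul_ne h]
    · rw [ofPath_mul_ne h', mul_def, map_zero]

/-- The grading of `kQ` by path length. -/
def grading (k : Type u) (V : Type v) [Field k] [Quiver.{v} V] (n : ℕ) :
    Submodule k (PathAlgebra k V) :=
  Submodule.span k {z | ∃ p : QPath V, p.2.2.length = n ∧ z = ofPath k p}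

theorem ofPath_mem_grading (p : QPath V) : ofPath k p ∈ grading k V p.2.2.length :=
  Submodule.subset_span ⟨p, rfl, rfl⟩

/-- The decomposition of an element of `kQ` into homogeneous components. -/
def decomp : PathAlgebra k V →ₗ[k] DirectSum ℕ (fun n => grading k V n) :=
  liftPath fun p => DirectSum.lof k ℕ (fun n => grading k V n) p.2.2.length
    ⟨ofPath k p, ofPath_mem_grading p⟩

theorem decomp_ofPath (p : QPath V) : decomp (ofPath k p) =
    DirectSum.lof k ℕ (fun n => grading k V n) p.2.2.length
      ⟨ofPath k p, ofPath_mem_grading p⟩ :=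
  liftPath_ofPath _ p

theorem smul_mul' (c : k) (a b : PathAlgebra k V) : c • a * b = c • (a * b) := by
  rw [mul_def, mul_def, map_smul, LinearMap.smul_apply]

theorem mul_smul' (c : k) (a b : PathAlgebra k V) : a * c • b = c • (a * b) :=
  map_smul (mulLin a) c b

variable [Fintype V]

/-- The identity of `kQ`: the sum of the trivial paths. -/
instance : One (PathAlgebra k V) := ⟨∑ a : V, ofPath k ⟨a, a, Quiver.Path.nil⟩⟩

theorem one_def : (1 : PathAlgebra k V) = ∑ a : V, ofPath k ⟨a, a, Quiver.Path.nil⟩ := rfl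

theorem one_mul_ofPath (p : QPath V) : (1 : PathAlgebra k V) * ofPath k p = ofPath k p := by
  rw [one_def, mul_def, map_sum, LinearMap.sum_apply, Finset.sum_eq_single p.1]
  · rw [← mul_def, ofPath_mul_comp, Quiver.Path.nil_comp]
  · intro a _ ha
    rw [← mul_def]
    exact ofPath_mul_ne (Ne.symm ha)
  · intro h; exact absurd (Finset.mem_univ _) h

theorem ofPath_mul_one (p : QPath V) : ofPath k p * (1 : PathAlgebra k V) = ofPath k p := by
  rw [one_def, mul_def, map_sum, Finset.sum_eq_single p.2.1]
  · rw [← mul_def, ofPath_mul_comp, Quiver.Path.comp_nil]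
  · intro a _ ha
    rw [← mul_def]
    exact ofPath_mul_ne ha
  · intro h; exact absurd (Finset.mem_univ _) h

instance : Ring (PathAlgebra k V) :=
  { (inferInstanceAs (AddCommGroup (QPath V →₀ k)) : AddCommGroup (PathAlgebra k V)) with
    mul := (· * ·)
    one := 1
    left_distrib := fun a b c => map_add (mulLin a) b c
    right_distrib := fun a b c => by
      rw [mul_def, mul_def, mul_def, map_add, LinearMap.add_apply]
    zero_mul := fun a => by rw [mul_def, map_zero, LinearMap.zero_apply]
    mul_zero := fun a => map_zero (mulLin a)
    mul_assoc := fun a b c => by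
      have h1 : ∀ p q, mulLin (ofPath k p * ofPath k q) =
          mulLin (ofPath k p) ∘ₗ mulLin (k := k) (V := V) (ofPath k q) :=
        fun p q => linearMap_ext (ofPath_mul_assoc p q)
      have h2 : ∀ p, mulLin ∘ₗ mulLin (ofPath k p) =
          (LinearMap.llcomp k _ _ _ (mulLin (ofPath k p))) ∘ₗ mulLin (k := k) (V := V) :=
        fun p => linearMap_ext (h1 p)
      have h3 : (LinearMap.llcomp k _ _ _ mulLin) ∘ₗ mulLin (k := k) (V := V) =
          (LinearMap.lcomp k _ mulLin) ∘ₗ (LinearMap.llcomp k _ _ _) ∘ₗ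
            mulLin (k := k) (V := V) := linearMap_ext h2
      exact congrArg (fun g => g a b c) h3
    one_mul := fun a => by
      have : mulLin (1 : PathAlgebra k V) = LinearMap.id := linearMap_ext one_mul_ofPath
      exact congrArg (fun g => g a) this
    mul_one := fun a => by
      have : (mulLin (k := k) (V := V)).flip 1 = LinearMap.id := linearMap_ext ofPath_mul_one
      exact congrArg (fun g => g a) this }

instance : Algebra k (PathAlgebra k V) :=
  Algebra.ofModule smul_mul' mul_smul'

instance : SetLike.GradedMonoid (grading k V) where
  one_mem := by
    rw [one_def]
    exact Submodule.sum_mem _ fun a _ => ofPath_mem_grading (k := k) (⟨a, a, Quiver.Path.nil⟩ : QPath V)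
  mul_mem := by
    intro m n y z hy hz
    induction hy using Submodule.span_induction with
    | zero => rw [zero_mul]; exact Submodule.zero_mem _
    | add y y' _ _ hy hy' => rw [add_mul]; exact Submodule.add_mem _ hy hy'
    | smul c y _ hy => rw [smul_mul_assoc]; exact Submodule.smul_mem _ _ hy
    | mem y hy =>
      obtain ⟨⟨a, b, p⟩, rfl, rfl⟩ := hy
      induction hz using Submodule.span_induction with
      | zero => rw [mul_zero]; exact Submodule.zero_mem _
      | add y y' _ _ hy hy' => rw [mul_add]; exact Submodule.add_mem _ hy hy'
      | smul c y _ hy => rw [mul_smul_comm]; exact Submodule.smul_mem _ _ hy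
      | mem z hz =>
        obtain ⟨⟨b', c, q⟩, rfl, rfl⟩ := hz
        by_cases h : b' = b
        · subst h
          rw [ofPath_mul_comp, ← Quiver.Path.length_comp]
          exact ofPath_mem_grading (k := k) (⟨a, c, p.comp q⟩ : QPath V)
        · rw [ofPath_mul_ne h]
          exact Submodule.zero_mem _

instance : DirectSum.Decomposition (grading k V) :=
  DirectSum.Decomposition.ofLinearMap _ decomp
    (by
      apply linearMap_ext
      intro p
      rw [LinearMap.comp_apply, decomp_ofPath, DirectSum.coeLinearMap_lof]
      rfl)
    (by
      apply DirectSum.linearMap_ext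
      intro n
      ext ⟨z, hz⟩ : 1
      simp only [LinearMap.comp_apply, DirectSum.coeLinearMap_lof, LinearMap.id_apply]
      induction hz using Submodule.span_induction with
      | mem z hz =>
        obtain ⟨p, rfl, rfl⟩ := hz
        exact decomp_ofPath p
      | zero => rw [map_zero]; exact (map_zero _).symm
      | add y z hy' hz' hy hz => rw [map_add, hy, hz, ← map_add]; rfl
      | smul c y hy' hy => rw [map_smul, hy, ← map_smul]; rfl)

instance : GradedAlgebra (grading k V) where

end PathAlgebra

/-! ### Monomial algebras -/

/-- A word in the letters `G`, as an element of the free algebra `k⟨G⟩`. -/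
def word (k : Type u) {G : Type v} [Field k] (w : List G) : FreeAlgebra k G :=
  (w.map (FreeAlgebra.ι k)).prod

/-- The two-sided ideal `(F)` of `k⟨G⟩` generated by a finite set `F` of words. -/
def monomialIdeal (k : Type u) {G : Type v} [Field k] (F : Finset (List G)) :
    TwoSidedIdeal (FreeAlgebra k G) :=
  TwoSidedIdeal.span {z | ∃ w ∈ F, z = word k w}

/-- The monomial algebra `k⟨G⟩/(F)`. -/
abbrev MonomialAlgebra (k : Type u) {G : Type v} [Field k] (F : Finset (List G)) :
    Type (max u v) :=
  (monomialIdeal k F).ringCon.Quotient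

/-- A word is legal if it does not belong to the ideal `(F)`. -/
def IsLegal (k : Type u) {G : Type v} [Field k] (F : Finset (List G)) (w : List G) : Prop :=
  word k w ∉ monomialIdeal k F

/-- The number `ℓ` such that `ℓ + 1` is the longest length of a word in `F`
(and `ℓ = 0` if `F` is empty). -/
def ell {G : Type v} (F : Finset (List G)) : ℕ := F.sup List.length - 1

section Words

variable {k : Type u} {G : Type v} [Field k] {F : Finset (List G)}

theorem word_nil : word k ([] : List G) = 1 := rfl

theorem word_cons (x : G) (w : List G) : word k (x :: w) = FreeAlgebra.ι k x * word k w := by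
  simp [word]

theorem word_append (v w : List G) : word k (v ++ w) = word k v * word k w := by
  simp [word]

theorem length_le_ell {w : List G} (hw : w ∈ F) : w.length ≤ ell F + 1 := by
  have := Finset.le_sup (f := List.length) hw
  unfold ell
  omega

theorem IsLegal.of_append {v w : List G} (h : IsLegal k F (v ++ w)) : IsLegal k F v := by
  intro hv
  apply h
  rw [word_append]
  exact TwoSidedIdeal.mul_mem_right _ _ _ hv

theorem not_isLegal_of_mem {w : List G} (hw : w ∈ F) : ¬ IsLegal k F w :=
  fun h => h (TwoSidedIdeal.subset_span ⟨w, hw, rfl⟩)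

end Words

namespace MonomialAlgebra

/-- The quotient map `k⟨G⟩ → k⟨G⟩/(F)`. -/
def mk (k : Type u) {G : Type v} [Field k] (F : Finset (List G)) :
    FreeAlgebra k G →ₐ[k] MonomialAlgebra k F :=
  (monomialIdeal k F).ringCon.mkₐ k

/-- A homomorphism of `k`-algebras on `k⟨G⟩` which vanishes on `F` induces one on `k⟨G⟩/(F)`. -/
def lift {k : Type u} {G : Type v} [Field k] {F : Finset (List G)} {B : Type*} [Semiring B]
    [Algebra k B] (f : FreeAlgebra k G →ₐ[k] B) (hf : ∀ w ∈ F, f (word k w) = 0) :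
    MonomialAlgebra k F →ₐ[k] B :=
  (monomialIdeal k F).ringCon.liftₐ f (by
    have hle : monomialIdeal k F ≤ TwoSidedIdeal.ofRingCon (RingCon.ker f.toRingHom) := by
      rw [monomialIdeal, TwoSidedIdeal.span_le]
      rintro _ ⟨w, hw, rfl⟩
      exact (hf w hw).trans (map_zero f).symm
    exact TwoSidedIdeal.ringCon_le_iff.1 hle)

variable {k : Type u} {G : Type v} [Field k] {F : Finset (List G)}

@[simp] theorem lift_mk {B : Type*} [Semiring B] [Algebra k B] (f : FreeAlgebra k G →ₐ[k] B)
    (hf : ∀ w ∈ F, f (word k w) = 0) (z : FreeAlgebra k G) : lift f hf (mk k F z) = f z := rfl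

theorem mk_surjective : Function.Surjective (mk k F) := Quotient.mk''_surjective

theorem mk_word_of_mem {w : List G} (hw : w ∈ F) : mk k F (word k w) = 0 :=
  (RingCon.eq _).2 (TwoSidedIdeal.subset_span ⟨w, hw, rfl⟩ : word k w ∈ monomialIdeal k F)

/-- The grading of `k⟨G⟩/(F)` in which the letters have degree one: the component of degree `n` is
spanned by the images of the words of length `n`. -/
def grading (k : Type u) {G : Type v} [Field k] (F : Finset (List G)) (n : ℕ) :
    Submodule k (MonomialAlgebra k F) :=
  Submodule.span k {z | ∃ w : List G, w.length = n ∧ z = mk k F (word k w)}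

theorem word_mem_grading (w : List G) : mk k F (word k w) ∈ grading k F w.length :=
  Submodule.subset_span ⟨w, rfl, rfl⟩

theorem letter_mem_grading (x : G) : mk k F (FreeAlgebra.ι k x) ∈ grading k F 1 :=
  Submodule.subset_span ⟨[x], rfl, by simp [word]⟩

instance : SetLike.GradedMonoid (grading k F) where
  one_mem := Submodule.subset_span ⟨[], rfl, (map_one (mk k F)).symm⟩
  mul_mem := by
    intro m n y z hy hz
    induction hy using Submodule.span_induction with
    | zero => rw [zero_mul]; exact Submodule.zero_mem _
    | add y y' _ _ hy hy' => rw [add_mul]; exact Submodule.add_mem _ hy hy'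
    | smul c y _ hy => rw [smul_mul_assoc]; exact Submodule.smul_mem _ _ hy
    | mem y hy =>
      obtain ⟨p, rfl, rfl⟩ := hy
      induction hz using Submodule.span_induction with
      | zero => rw [mul_zero]; exact Submodule.zero_mem _
      | add y y' _ _ hy hy' => rw [mul_add]; exact Submodule.add_mem _ hy hy'
      | smul c y _ hy => rw [mul_smul_comm]; exact Submodule.smul_mem _ _ hy
      | mem z hz =>
        obtain ⟨q, rfl, rfl⟩ := hz
        rw [← map_mul, ← word_append, ← List.length_append]
        exact word_mem_grading (p ++ q)

/-- The decomposition into homogeneous components, on the free algebra. -/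
def freeDecomp (k : Type u) {G : Type v} [Field k] (F : Finset (List G)) :
    FreeAlgebra k G →ₐ[k] DirectSum ℕ (fun n => grading k F n) :=
  FreeAlgebra.lift k fun x => DirectSum.of (fun n => grading k F n) 1
    ⟨mk k F (FreeAlgebra.ι k x), letter_mem_grading x⟩

theorem freeDecomp_word (w : List G) : freeDecomp k F (word k w) =
    DirectSum.of (fun n => grading k F n) w.length ⟨mk k F (word k w), word_mem_grading w⟩ := by
  induction w with
  | nil => exact map_one (freeDecomp k F)
  | cons x w ih =>
    have h : freeDecomp k F (word k (x :: w)) =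
        freeDecomp k F (FreeAlgebra.ι k x) * freeDecomp k F (word k w) := by
      rw [word_cons, map_mul]
    rw [h, ih, freeDecomp, FreeAlgebra.lift_ι_apply, DirectSum.of_mul_of]
    apply DirectSum.of_eq_of_gradedMonoid_eq
    apply Sigma.subtype_ext
    · exact Nat.add_comm _ _
    · change mk k F (FreeAlgebra.ι k x) * mk k F (word k w) = mk k F (word k (x :: w))
      rw [word_cons, map_mul]

/-- The decomposition into homogeneous components. -/
def decomp (k : Type u) {G : Type v} [Field k] (F : Finset (List G)) :
    MonomialAlgebra k F →ₐ[k] DirectSum ℕ (fun n => grading k F n) :=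
  lift (freeDecomp k F) (fun w hw => by
    rw [freeDecomp_word]
    have : (⟨mk k F (word k w), word_mem_grading w⟩ : grading k F w.length) = 0 :=
      Subtype.ext (mk_word_of_mem hw)
    rw [this, map_zero])

/-- `k⟨G⟩/(F)` is a graded algebra. -/
instance : GradedAlgebra (grading k F) :=
  GradedAlgebra.ofAlgHom _
    (decomp k F)
    (by
      have h : ((DirectSum.coeAlgHom (grading k F)).comp (freeDecomp k F)) = mk k F := by
        apply FreeAlgebra.hom_ext
        funext x
        simp [freeDecomp]
      apply AlgHom.ext
      intro z
      obtain ⟨z, rfl⟩ := mk_surjective z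
      exact congrArg (fun g => g z) h)
    (by
      rintro n ⟨z, hz⟩
      induction hz using Submodule.span_induction with
      | mem z hz =>
        obtain ⟨w, rfl, rfl⟩ := hz
        exact freeDecomp_word w
      | zero => rw [map_zero]; exact (map_zero _).symm
      | add y z hy' hz' hy hz => rw [map_add, hy, hz, ← map_add]; rfl
      | smul c y hy' hy =>
        rw [map_smul, hy]
        exact (map_smul (DirectSum.lof k ℕ (fun n => grading k F n) n) c ⟨y, hy'⟩).symm)

end MonomialAlgebra

/-! ### The Ufnarovskii graph -/

/-- The vertices of the Ufnarovskii graph: the legal words of length `ℓ`. -/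
def UfnGraph (k : Type u) {G : Type v} [Field k] (F : Finset (List G)) : Type v :=
  {w : List G // w.length = ell F ∧ IsLegal k F w}

namespace UfnGraph

variable {k : Type u} {G : Type v} [Field k] {F : Finset (List G)}

/-- The arrows `s ⟶ t` of the Ufnarovskii graph: the legal words `w` of length `ℓ + 1` such that
`w = s y = x t` for some letters `x` and `y`. -/
instance : Quiver.{v} (UfnGraph k F) where
  Hom s t := {w : List G // w.length = ell F + 1 ∧ IsLegal k F w ∧
    (∃ y : G, w = s.1 ++ [y]) ∧ ∃ x : G, w = x :: t.1}

/-- The label of an arrow: the first letter of the corresponding word. -/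
def label {s t : UfnGraph k F} (a : s ⟶ t) : G :=
  a.1.head (List.ne_nil_of_length_eq_add_one a.2.1)

instance [Finite G] : Finite (UfnGraph k F) :=
  ((List.finite_length_eq G (ell F)).subset fun _ h => h.1 :
    {w : List G | w.length = ell F ∧ IsLegal k F w}.Finite).to_subtype

instance [Finite G] (s t : UfnGraph k F) : Finite (s ⟶ t) :=
  ((List.finite_length_eq G (ell F + 1)).subset fun _ h => h.1 :
    {w : List G | w.length = ell F + 1 ∧ IsLegal k F w ∧
      (∃ y : G, w = s.1 ++ [y]) ∧ ∃ x : G, w = x :: t.1}.Finite).to_subtype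

instance [Finite G] : Fintype (UfnGraph k F) := Fintype.ofFinite _

instance [Finite G] (s t : UfnGraph k F) : Fintype (s ⟶ t) := Fintype.ofFinite _

/-- The label of a path: the concatenation of the labels of its arrows. -/
def pathLabel {s : UfnGraph k F} : {t : UfnGraph k F} → Quiver.Path s t → List G
  | _, .nil => []
  | _, .cons p a => pathLabel p ++ [label a]

theorem word_eq_cons {s t : UfnGraph k F} (a : s ⟶ t) : a.1 = label a :: t.1 := by
  obtain ⟨x, hx⟩ := a.2.2.2.2
  simp only [label, hx, List.head_cons]

theorem pathLabel_length {s t : UfnGraph k F} (p : Quiver.Path s t) :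
    (pathLabel p).length = p.length := by
  induction p with
  | nil => rfl
  | cons p a ih => simp [pathLabel, ih]

theorem pathLabel_comp {r s t : UfnGraph k F} (p : Quiver.Path r s) (q : Quiver.Path s t) :
    pathLabel (p.comp q) = pathLabel p ++ pathLabel q := by
  induction q with
  | nil => simp [pathLabel]
  | cons q a ih => simp [pathLabel, ih]

theorem exists_prefix {s t : UfnGraph k F} (p : Quiver.Path s t) (hp : p.length ≠ 0) :
    ∃ w v : List G, w.length = ell F + 1 ∧ IsLegal k F w ∧ pathLabel p ++ t.1 = w ++ v := by
  induction p with
  | nil => exact absurd rfl hp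
  | @cons b c p a ih =>
    by_cases h : p.length = 0
    · refine ⟨a.1, [], a.2.1, a.2.2.1, ?_⟩
      have : pathLabel p = [] := List.eq_nil_of_length_eq_zero (by rw [pathLabel_length, h])
      rw [pathLabel, this, word_eq_cons]
      simp
    · obtain ⟨w, v, h1, h2, h3⟩ := ih h
      obtain ⟨y, hy⟩ := a.2.2.2.1
      refine ⟨w, v ++ [y], h1, h2, ?_⟩
      rw [pathLabel, List.append_assoc, List.singleton_append, ← word_eq_cons, hy,
        ← List.append_assoc, h3, List.append_assoc]

theorem isLegal_pathLabel {s t : UfnGraph k F} (p : Quiver.Path s t)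
    (hp : p.length ≤ ell F + 1) : IsLegal k F (pathLabel p) := by
  by_cases h : p.length = 0
  · have : pathLabel p = [] := List.eq_nil_of_length_eq_zero (by rw [pathLabel_length, h])
    rw [this]
    exact IsLegal.of_append (v := []) (w := s.1) s.2.2
  · obtain ⟨w, v, h1, h2, h3⟩ := exists_prefix p h
    have hpre : pathLabel p <+: w := by
      apply List.prefix_of_prefix_length_le (l₃ := w ++ v)
      · rw [← h3]; exact List.prefix_append _ _
      · exact List.prefix_append _ _
      · rw [pathLabel_length, h1]; exact hp
    obtain ⟨u, rfl⟩ := hpre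
    exact h2.of_append

open Classical in
/-- The sum in `kQ` of all the arrows labeled `x`. -/
def arrowSum (k : Type u) {G : Type v} [Field k] [Finite G] (F : Finset (List G)) (x : G) :
    PathAlgebra k (UfnGraph k F) :=
  ∑ s : UfnGraph k F, ∑ t : UfnGraph k F, ∑ a : s ⟶ t,
    if label a = x then PathAlgebra.ofPath k ⟨s, t, a.toPath⟩ else 0

variable [Finite G]

/-- The homomorphism `f : k⟨G⟩ → kQ` which sends each letter `x` to the sum of the arrows
labeled `x`. -/
def freeHom (k : Type u) {G : Type v} [Field k] [Finite G] (F : Finset (List G)) :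
    FreeAlgebra k G →ₐ[k] PathAlgebra k (UfnGraph k F) :=
  FreeAlgebra.lift k (arrowSum k F)

theorem freeHom_word (w : List G) : freeHom k F (word k w) ∈
    Submodule.span k {z | ∃ p : QPath (UfnGraph k F), pathLabel p.2.2 = w ∧
      z = PathAlgebra.ofPath k p} := by
  induction w with
  | nil =>
    rw [word_nil, map_one, PathAlgebra.one_def]
    exact Submodule.sum_mem _ fun a _ =>
      Submodule.subset_span ⟨⟨a, a, Quiver.Path.nil⟩, rfl, rfl⟩
  | cons x w ih =>
    rw [word_cons, map_mul, freeHom, FreeAlgebra.lift_ι_apply, arrowSum]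
    simp only [Finset.sum_mul]
    refine Submodule.sum_mem _ fun s _ => Submodule.sum_mem _ fun t _ =>
      Submodule.sum_mem _ fun a _ => ?_
    split_ifs with hx
    · change PathAlgebra.ofPath k _ * freeHom k F (word k w) ∈ _
      generalize freeHom k F (word k w) = z at ih
      induction ih using Submodule.span_induction with
      | zero => rw [mul_zero]; exact Submodule.zero_mem _
      | add y y' _ _ hy hy' => rw [mul_add]; exact Submodule.add_mem _ hy hy'
      | smul c y _ hy => rw [mul_smul_comm]; exact Submodule.smul_mem _ _ hy
      | mem z hz =>
        obtain ⟨⟨b, c, q⟩, rfl, rfl⟩ := hz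
        by_cases h : b = t
        · subst h
          rw [PathAlgebra.ofPath_mul_comp]
          refine Submodule.subset_span ⟨⟨s, c, a.toPath.comp q⟩, ?_, rfl⟩
          rw [pathLabel_comp, ← hx]
          rfl
        · rw [PathAlgebra.ofPath_mul_ne h]
          exact Submodule.zero_mem _
    · rw [zero_mul]
      exact Submodule.zero_mem _

theorem freeHom_word_of_mem {w : List G} (hw : w ∈ F) : freeHom k F (word k w) = 0 := by
  have hempty : {z | ∃ p : QPath (UfnGraph k F), pathLabel p.2.2 = w ∧
      z = PathAlgebra.ofPath k p} = ∅ := by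
    rw [Set.eq_empty_iff_forall_notMem]
    rintro _ ⟨p, hp, rfl⟩
    have hlen : p.2.2.length ≤ ell F + 1 := by
      rw [← pathLabel_length, hp]
      exact length_le_ell hw
    apply not_isLegal_of_mem (k := k) hw
    rw [← hp]
    exact isLegal_pathLabel p.2.2 hlen
  have := freeHom_word (k := k) (F := F) w
  rwa [hempty, Submodule.span_empty, Submodule.mem_bot] at this

/-- The homomorphism `k⟨G⟩/(F) → kQ` induced by `f`. -/
def hom (k : Type u) {G : Type v} [Field k] [Finite G] (F : Finset (List G)) :
    MonomialAlgebra k F →ₐ[k] PathAlgebra k (UfnGraph k F) :=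
  MonomialAlgebra.lift (freeHom k F) fun _ hw => freeHom_word_of_mem hw

/-- The homomorphism `k⟨G⟩/(F) → kQ` is graded. -/
theorem hom_mem_grading (n : ℕ) (z : MonomialAlgebra k F)
    (hz : z ∈ MonomialAlgebra.grading k F n) :
    hom k F z ∈ PathAlgebra.grading k (UfnGraph k F) n := by
  induction hz using Submodule.span_induction with
  | zero => rw [map_zero]; exact Submodule.zero_mem _
  | add y y' _ _ hy hy' => rw [map_add]; exact Submodule.add_mem _ hy hy'
  | smul c y _ hy => rw [map_smul]; exact Submodule.smul_mem _ _ hy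
  | mem z hz =>
    obtain ⟨w, rfl, rfl⟩ := hz
    refine Submodule.span_mono ?_ (freeHom_word (k := k) (F := F) w)
    rintro _ ⟨p, hp, rfl⟩
    exact ⟨p, by rw [← hp, pathLabel_length], rfl⟩

end UfnGraph

end

/-! Write `B = kQ`, and `f` for the graded homomorphism from `A` to `B`. Extension and restriction
of scalars along `f` are linked by the unit `M → M ⊗_A B` and the counit `N ⊗_A B → N`. If both
functors preserve the morphisms with kernel and cokernel in `Fdim`, and if the unit and counit are
such morphisms, the functors become mutually inverse after localization
(`exists_localization_equivalence`).

Everything rests on one property of the Ufnarovskii graph (`exists_factorization`): for `a` in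
`A_ℓ`, right multiplication by `f(a)` on `B` is a composite `f ∘ θ`, with `θ : B → A` left
`A`-linear and `θ(1) = a`. By linearity `a` may be taken to be a word `u` of length `ℓ`. A path `p`
with label `w` and last vertex `t` equals `f(w) e_t`, because an arrow is determined by its target
and its label. A path labeled `u` starts at the vertex `u`, so `p f(u)` is `f(wu)` if `t = u` and
zero otherwise. Accordingly `θ` sends `p` to `wu` or to zero. Linearity holds because an arrow
labeled `x` into the first vertex `s` of `p` exists exactly when `xs` is legal; if it is not, `xwu`
begins with the illegal word `xs` and vanishes in `A`.

Given `θ`, the rest is formal (`exists_qGr_equivalence`). If `m ⊗ 1 = 0`, then `m a = m θ(1) = 0`.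
Moreover `(m ⊗ b) f(a) = m ⊗ f(θ b) = m θ(b) ⊗ 1`, so the kernel and cokernel of the unit are killed
by `A_ℓ`. The counit `ε` is surjective, and `t f(a) = ε(t) f(a) ⊗ 1` shows that `A_ℓ` kills its
kernel. As `A` is generated in degree one with finite-dimensional components, being killed by `A_ℓ`
implies membership in `Fdim`; as `B_n ⊆ f(A_n) B`, torsion over `A` and over `B` agree. Extension of
scalars then preserves the class by naturality of the unit, with no flatness argument. -/

noncomputable section

/-! ### Localization of an adjoint-like pair of functors. -/

/-- Two functors which preserve given classes of morphisms and are mutually inverse up to these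
classes induce an equivalence of the localized categories. -/
theorem CategoryTheory.MorphismProperty.exists_localization_equivalence
    {C D : Type*} [Category* C] [Category* D]
    {W₁ : MorphismProperty C} {W₂ : MorphismProperty D} (F : C ⥤ D) (R : D ⥤ C)
    (hF : ∀ ⦃X Y : C⦄ (f : X ⟶ Y), W₁ f → W₂ (F.map f))
    (hR : ∀ ⦃X Y : D⦄ (f : X ⟶ Y), W₂ f → W₁ (R.map f))
    (η : 𝟭 C ⟶ F ⋙ R) (hη : ∀ X, W₁ (η.app X))
    (ε : R ⋙ F ⟶ 𝟭 D) (hε : ∀ X, W₂ (ε.app X)) :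
    ∃ Φ : W₁.Localization ⥤ W₂.Localization,
      Φ.IsEquivalence ∧ Nonempty (W₁.Q ⋙ Φ ≅ F ⋙ W₂.Q) := by
  have hF' : W₁.IsInvertedBy (F ⋙ W₂.Q) := fun _ _ f hf =>
    Localization.inverts W₂.Q W₂ _ (hF f hf)
  have hR' : W₂.IsInvertedBy (R ⋙ W₁.Q) := fun _ _ f hf =>
    Localization.inverts W₁.Q W₁ _ (hR f hf)
  -- The components of `η` and `ε` lie in the inverted classes, so both transformations become
  -- isomorphisms after composing with the quotient functors.
  have h₁ : ∀ X, IsIso ((Functor.whiskerRight η W₁.Q).app X) := fun X =>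
    Localization.inverts W₁.Q W₁ _ (hη X)
  have h₂ : ∀ X, IsIso ((Functor.whiskerRight ε W₂.Q).app X) := fun X =>
    Localization.inverts W₂.Q W₂ _ (hε X)
  have := NatIso.isIso_of_isIso_app (Functor.whiskerRight η W₁.Q)
  have := NatIso.isIso_of_isIso_app (Functor.whiskerRight ε W₂.Q)
  let Φ := Localization.lift (F ⋙ W₂.Q) hF' W₁.Q
  let Ψ := Localization.lift (R ⋙ W₁.Q) hR' W₂.Q
  let eΦ : W₁.Q ⋙ Φ ≅ F ⋙ W₂.Q := Localization.fac (F ⋙ W₂.Q) hF' W₁.Q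
  let eΨ : W₂.Q ⋙ Ψ ≅ R ⋙ W₁.Q := Localization.fac (R ⋙ W₁.Q) hR' W₂.Q
  refine ⟨Φ, ?_, ⟨eΦ⟩⟩
  exact Localization.isEquivalence W₁.Q W₁ W₂.Q W₂ (F ⋙ W₂.Q) Φ (R ⋙ W₁.Q) Ψ
    (Functor.associator _ _ _ ≪≫ Functor.isoWhiskerLeft F eΨ ≪≫ (Functor.associator _ _ _).symm ≪≫
      (asIso (Functor.whiskerRight η W₁.Q)).symm ≪≫ Functor.leftUnitor _)
    (Functor.associator _ _ _ ≪≫ Functor.isoWhiskerLeft R eΦ ≪≫ (Functor.associator _ _ _).symm ≪≫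
      asIso (Functor.whiskerRight ε W₂.Q) ≪≫ Functor.leftUnitor _)

namespace GrMod

open MulOpposite (op)

/-! ### Torsion elements, and morphisms that are invertible modulo `Fdim`. -/

section Torsion

variable {k : Type u} {A : Type x} [Field k] [Ring A] [Algebra k A]
  {𝒜 : ℕ → Submodule k A} [GradedAlgebra 𝒜]

/-- The elements of sufficiently large degree of the algebra send `m` into `K`. -/
def EventuallyMem (M : GrMod 𝒜) (K : Submodule Aᵐᵒᵖ M) (m : M) : Prop :=
  ∃ N, ∀ n, N ≤ n → ∀ a ∈ 𝒜 n, op a • m ∈ K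

namespace EventuallyMem

variable {M : GrMod 𝒜} {K : Submodule Aᵐᵒᵖ M}

theorem of_mem {m : M} (h : m ∈ K) : M.EventuallyMem K m :=
  ⟨0, fun _ _ _ _ => K.smul_mem _ h⟩

theorem add {m m' : M} (h : M.EventuallyMem K m) (h' : M.EventuallyMem K m') :
    M.EventuallyMem K (m + m') := by
  obtain ⟨N, hN⟩ := h
  obtain ⟨N', hN'⟩ := h'
  refine ⟨max N N', fun n hn a ha => ?_⟩
  rw [smul_add]
  exact K.add_mem (hN n (by omega) a ha) (hN' n (by omega) a ha)

/-- Over an algebra generated in degree one with finite-dimensional components, it suffices to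
check the products with the elements of a fixed degree. -/
theorem of_smul (hgen : ∀ i j, 𝒜 (i + j) ≤ 𝒜 i * 𝒜 j) (hfin : ∀ n, Module.Finite k (𝒜 n))
    {m : M} (d : ℕ) (h : ∀ a ∈ 𝒜 d, M.EventuallyMem K (op a • m)) : M.EventuallyMem K m := by
  obtain ⟨S, hS⟩ := (Module.Finite.iff_fg.1 (hfin d))
  have hSd : ∀ s ∈ S, s ∈ 𝒜 d := fun s hs => hS ▸ Submodule.subset_span hs
  choose! N hN using fun s hs => h s (hSd s hs)
  -- Only the finitely many spanning elements of `𝒜 d` need a bound, so their maximum serves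
  -- uniformly; an element of degree `d + e` is a sum of products of degrees `d` and `e`.
  refine ⟨d + S.sup N, fun n hn a ha => ?_⟩
  obtain ⟨e, rfl⟩ := Nat.exists_eq_add_of_le (le_of_add_le_left hn)
  have he : S.sup N ≤ e := by omega
  refine Submodule.mul_induction_on (hgen d e ha) (fun b hb c hc => ?_) fun y z hy hz => ?_
  · rw [← hS] at hb
    induction hb using Submodule.span_induction with
    | mem s hs =>
      rw [MulOpposite.op_mul, mul_smul]
      exact hN s hs e ((Finset.le_sup hs).trans he) c hc
    | zero => rw [zero_mul, MulOpposite.op_zero, zero_smul]; exact K.zero_mem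
    | add y z _ _ hy hz => rw [add_mul, MulOpposite.op_add, add_smul]; exact K.add_mem hy hz
    | smul t y _ hy =>
      rw [smul_mul_assoc, MulOpposite.op_smul, smul_assoc]
      exact K.smul_of_tower_mem t hy
  · rw [MulOpposite.op_add, add_smul]; exact K.add_mem hy hz

end EventuallyMem

/-- A finite-dimensional module has only finitely many nonzero components, and multiplication by
large degrees pushes a homogeneous element past the last of them. -/
theorem eventuallyMem_bot_of_finite (M : GrMod 𝒜) [hM : FiniteDimensional k M] (m : M) :
    M.EventuallyMem ⊥ m := by
  induction m using M.induction_deg with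
  | h0 => exact .of_mem (zero_mem _)
  | hadd y z hy hz => exact hy.add hz
  | hom i m hm =>
    have hf := WellFoundedGT.finite_ne_bot_of_iSupIndep M.isInternal.submodule_iSupIndep
    obtain ⟨J, hJ⟩ := hf.bddAbove
    -- `J` bounds the degrees of the nonzero components. If `J - i + 1` is negative, the truncation
    -- to `0` is harmless, as `i` already exceeds `J`.
    refine ⟨(J - i + 1).toNat, fun n hn a ha => ?_⟩
    have hbot : M.deg (i + n) = ⊥ := by
      by_contra hne
      have : i + n ≤ J := hJ hne
      omega
    have := M.smul_mem hm ha
    rw [hbot, Submodule.mem_bot] at this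
    rw [this]
    exact zero_mem _

/-- For the converse, the cyclic submodule generated by a homogeneous torsion element is graded, and
it is spanned by the images of the components of `A` of degree below the bound, each of which is
finite-dimensional. -/
theorem fdim_iff (hfin : ∀ n, Module.Finite k (𝒜 n)) (M : GrMod 𝒜) :
    fdim 𝒜 M ↔ ∀ m, M.EventuallyMem ⊥ m := by
  constructor
  · intro h m
    have hm : m ∈ sSup {K : Submodule Aᵐᵒᵖ M | M.IsGradedSub K ∧ FiniteDimensional k K} := by
      rw [show _ = ⊤ from h]; trivial
    rw [sSup_eq_iSup'] at hm
    refine Submodule.iSup_induction _ (motive := M.EventuallyMem ⊥) hm ?_ (.of_mem (zero_mem _))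
      fun _ _ hx hy => hx.add hy
    rintro ⟨K, hK, hfd⟩ m hm
    obtain ⟨N, hN⟩ := eventuallyMem_bot_of_finite (M.sub K hK) (hM := hfd) (⟨m, hm⟩ : K)
    exact ⟨N, fun n hn a ha => congrArg Subtype.val (hN n hn a ha)⟩
  · intro h
    refine Submodule.eq_top_iff'.2 fun m => ?_
    induction m using M.induction_deg with
    | h0 => exact zero_mem _
    | hadd y z hy hz => exact add_mem hy hz
    | hom i m hm =>
      have hmem : m ∈ Submodule.span Aᵐᵒᵖ {m} := Submodule.mem_span_singleton_self m
      suffices hK : Submodule.span Aᵐᵒᵖ {m} ∈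
          {K : Submodule Aᵐᵒᵖ M | M.IsGradedSub K ∧ FiniteDimensional k K} from le_sSup hK hmem
      refine ⟨?_, ?_⟩
      · refine isGradedSub_span M _ fun s hs j => ?_
        rw [Set.mem_singleton_iff.1 hs]
        by_cases hij : i = j
        · rw [← hij, M.proj_same hm]; exact hmem
        · rw [M.proj_ne hm hij]; exact zero_mem _
      · obtain ⟨N, hN⟩ := h m
        let φ : A →ₗ[k] M := ((LinearMap.toSpanSingleton Aᵐᵒᵖ M m).restrictScalars k) ∘ₗ
          (MulOpposite.opLinearEquiv k).toLinearMap
        have hle : (Submodule.span Aᵐᵒᵖ {m}).restrictScalars k ≤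
            ⨆ n : Fin N, (𝒜 n).map φ := by
          intro y hy
          obtain ⟨b, rfl⟩ := Submodule.mem_span_singleton.1 hy
          obtain ⟨b, rfl⟩ := MulOpposite.op_surjective b
          induction b using DirectSum.Decomposition.inductionOn 𝒜 with
          | zero => rw [MulOpposite.op_zero, zero_smul]; exact zero_mem _
          | @homogeneous j b =>
            by_cases hj : j < N
            · exact Submodule.mem_iSup_of_mem (⟨j, hj⟩ : Fin N) ⟨b, b.2, rfl⟩
            · have := hN j (by omega) b b.2
              rw [Submodule.mem_bot] at this
              rw [this]; exact zero_mem _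
          | add b c hb hc =>
            rw [MulOpposite.op_add, add_smul]
            exact add_mem (hb (Submodule.smul_mem _ _ hmem)) (hc (Submodule.smul_mem _ _ hmem))
        exact Submodule.finiteDimensional_of_le hle

/-- Turns conditions on kernel and cokernel objects into conditions on elements, the form in which
all later arguments are made. -/
theorem isoModFdim_iff (hfin : ∀ n, Module.Finite k (𝒜 n)) {M N : GrMod 𝒜} (f : M ⟶ N) :
    isoModFdim 𝒜 f ↔ (∀ m, Hom.toLin f m = 0 → M.EventuallyMem ⊥ m) ∧
      ∀ n, N.EventuallyMem (LinearMap.range (Hom.toLin f)) n := by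
  refine and_congr ((fdim_iff hfin _).trans ?_) ((fdim_iff hfin _).trans ?_)
  · constructor
    · intro h m hm
      obtain ⟨n₀, hn⟩ := h (⟨m, hm⟩ : LinearMap.ker (Hom.toLin f))
      exact ⟨n₀, fun n h a ha => congrArg Subtype.val (hn n h a ha)⟩
    · rintro h ⟨m, hm⟩
      obtain ⟨n₀, hn⟩ := h m hm
      exact ⟨n₀, fun n h a ha => Subtype.ext (hn n h a ha)⟩
  · constructor
    · intro h m
      obtain ⟨n₀, hn⟩ := h (Submodule.Quotient.mk m : N ⧸ LinearMap.range (Hom.toLin f))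
      exact ⟨n₀, fun n h a ha => (Submodule.Quotient.mk_eq_zero _).1 (hn n h a ha)⟩
    · intro h m
      obtain ⟨m, rfl⟩ := Submodule.Quotient.mk_surjective _ m
      obtain ⟨n₀, hn⟩ := h m
      exact ⟨n₀, fun n h a ha => (Submodule.Quotient.mk_eq_zero _).2 (hn n h a ha)⟩

/-- Along a composite, torsion is detected in two stages: one product with a fixed degree moves the
element to where the other morphism applies, and `EventuallyMem.of_smul` combines the two bounds. -/
theorem isoModFdim_comp (hgen : ∀ i j, 𝒜 (i + j) ≤ 𝒜 i * 𝒜 j)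
    (hfin : ∀ n, Module.Finite k (𝒜 n)) {M N P : GrMod 𝒜} {f : M ⟶ N} {g : N ⟶ P}
    (hf : isoModFdim 𝒜 f) (hg : isoModFdim 𝒜 g) : isoModFdim 𝒜 (f ≫ g) := by
  rw [isoModFdim_iff hfin] at hf hg ⊢
  constructor
  · intro m hm
    obtain ⟨d, hd⟩ := hg.1 (Hom.toLin f m) hm
    refine .of_smul hgen hfin d fun a ha => hf.1 _ ?_
    rw [map_smul]
    exact hd d le_rfl a ha
  · intro p
    obtain ⟨d, hd⟩ := hg.2 p
    refine .of_smul hgen hfin d fun a ha => ?_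
    obtain ⟨n, hn⟩ := hd d le_rfl a ha
    obtain ⟨e, he⟩ := hf.2 n
    refine ⟨e, fun j hj b hb => ?_⟩
    obtain ⟨m, hm⟩ := he j hj b hb
    refine ⟨m, ?_⟩
    rw [← hn, ← map_smul, ← hm]
    rfl

/-- The cancellation half of two-out-of-three that transports the class along the unit: modulo
torsion, an element killed by `g` comes from an element killed by `f ≫ g`. -/
theorem isoModFdim_of_comp_left (hgen : ∀ i j, 𝒜 (i + j) ≤ 𝒜 i * 𝒜 j)
    (hfin : ∀ n, Module.Finite k (𝒜 n)) {M N P : GrMod 𝒜} {f : M ⟶ N} {g : N ⟶ P}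
    (hf : isoModFdim 𝒜 f) (hfg : isoModFdim 𝒜 (f ≫ g)) : isoModFdim 𝒜 g := by
  rw [isoModFdim_iff hfin] at hf hfg ⊢
  constructor
  · intro n hn
    obtain ⟨d, hd⟩ := hf.2 n
    refine .of_smul hgen hfin d fun a ha => ?_
    obtain ⟨m, hm⟩ := hd d le_rfl a ha
    obtain ⟨e, he⟩ := hfg.1 m (by
      change Hom.toLin g (Hom.toLin f m) = 0
      rw [hm, map_smul, hn, smul_zero])
    refine ⟨e, fun j hj b hb => ?_⟩
    have := he j hj b hb
    rw [Submodule.mem_bot] at this ⊢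
    rw [← hm, ← map_smul, this, map_zero]
  · intro p
    obtain ⟨d, hd⟩ := hfg.2 p
    exact ⟨d, fun j hj b hb => (LinearMap.range_comp_le_range _ _) (hd j hj b hb)⟩

end Torsion

open TensorProduct

/-! ### Restriction of scalars, and the unit and counit. -/

section Restrict

variable {k : Type u} {A B : Type x} [Field k] [Ring A] [Algebra k A] [Ring B] [Algebra k B]
  {𝒜 : ℕ → Submodule k A} [GradedAlgebra 𝒜] {ℬ : ℕ → Submodule k B} [GradedAlgebra ℬ]
  (f : A →ₐ[k] B) (hf : ∀ i, ∀ a ∈ 𝒜 i, f a ∈ ℬ i)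

/-- The graded right `A`-module obtained from a graded right `B`-module by restriction of scalars
along a graded homomorphism `f : A → B`. -/
def restrictObj (hf : ∀ i, ∀ a ∈ 𝒜 i, f a ∈ ℬ i) (N : GrMod ℬ) : GrMod 𝒜 :=
  letI : Module Aᵐᵒᵖ N.carrier := Module.compHom N.carrier f.toRingHom.op
  { carrier := N.carrier
    isScalarTower := ⟨fun c a n => by
      change op (f (c • a.unop)) • n = c • op (f a.unop) • n
      rw [map_smul, MulOpposite.op_smul, smul_assoc]⟩
    deg := N.deg
    isInternal := N.isInternal
    smul_mem := fun hm ha => N.smul_mem hm (hf _ _ ha) }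

/-- The restriction of scalars functor `Gr B ⥤ Gr A`. -/
def restrict (hf : ∀ i, ∀ a ∈ 𝒜 i, f a ∈ ℬ i) : GrMod ℬ ⥤ GrMod 𝒜 where
  obj := restrictObj f hf
  map {N P} φ :=
    { toLin :=
        { toFun := fun n => Hom.toLin φ n
          map_add' := map_add (Hom.toLin φ)
          map_smul' := fun a (n : N.carrier) => map_smul (Hom.toLin φ) (op (f a.unop)) n }
      map_deg := Hom.map_deg φ }

/-- The class of `m ⊗ b` in `M ⊗_A B`. -/
def tmul (M : GrMod 𝒜) : B →ₗ[Bᵐᵒᵖ] M →ₗ[k] (tensorObj (ℬ := ℬ) f hf M).carrier :=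
  TensorProduct.AlgebraTensorModule.curry
    (Submodule.mkQ (Submodule.span Bᵐᵒᵖ (tensorRel f M)))

variable {f hf}

theorem tmul_induction {M : GrMod 𝒜} {p : (tensorObj (ℬ := ℬ) f hf M).carrier → Prop}
    (h0 : p 0) (hadd : ∀ s t, p s → p t → p (s + t)) (h : ∀ b m, p (tmul f hf M b m))
    (t : (tensorObj (ℬ := ℬ) f hf M).carrier) : p t := by
  obtain ⟨t, rfl⟩ := Submodule.mkQ_surjective (Submodule.span Bᵐᵒᵖ (tensorRel f M)) t
  induction t using TensorProduct.induction_on with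
  | zero => exact h0
  | add s t hs ht => exact hadd _ _ hs ht
  | tmul b m => exact h b m

theorem tmul_smul (M : GrMod 𝒜) (b c : B) (m : M) :
    op c • tmul (ℬ := ℬ) f hf M b m = tmul f hf M (b * c) m := rfl

theorem tmul_op_smul (M : GrMod 𝒜) (a : A) (b : B) (m : M) :
    tmul (ℬ := ℬ) f hf M b (op a • m) = tmul f hf M (f a * b) m := by
  have : b ⊗ₜ[k] (op a • m) - (f a * b) ⊗ₜ[k] m ∈ Submodule.span Bᵐᵒᵖ (tensorRel f M) :=
    Submodule.subset_span ⟨m, a, b, rfl⟩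
  exact (Submodule.Quotient.eq _).2 this

theorem tmul_mem_deg (M : GrMod 𝒜) {i : ℤ} {j : ℕ} {m : M} {b : B} (hm : m ∈ M.deg i)
    (hb : b ∈ ℬ j) : tmul f hf M b m ∈ (tensorObj (ℬ := ℬ) f hf M).deg (i + j) :=
  ⟨_, M.tmul_mem_tensorDeg hm hb, rfl⟩

/-- A balanced additive map out of `M ⊗_k B` vanishes on the relations which define `M ⊗_A B`. -/
theorem map_eq_zero_of_mem_span_tensorRel {M : GrMod 𝒜} {W : Type*} [AddCommGroup W]
    (g : B ⊗[k] M →+ W) (hg : ∀ a b m, g (b ⊗ₜ (op a • m)) = g ((f a * b) ⊗ₜ m))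
    {t : B ⊗[k] M} (ht : t ∈ Submodule.span Bᵐᵒᵖ (tensorRel f M)) : g t = 0 := by
  -- `g` is only additive, so its kernel need not be a `B`-submodule; proving the claim for all
  -- multiples of `t` lets the span induction pass through scalars.
  suffices h : ∀ c : Bᵐᵒᵖ, g (c • t) = 0 by simpa using h 1
  induction ht using Submodule.span_induction with
  | mem t ht =>
    obtain ⟨m, a, b, rfl⟩ := ht
    intro c
    rw [smul_sub, map_sub, TensorProduct.smul_tmul', TensorProduct.smul_tmul', sub_eq_zero]
    exact (hg a (b * c.unop) m).trans (by rw [← mul_assoc]; rfl)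
  | zero => intro c; rw [smul_zero, map_zero]
  | add y z _ _ hy hz => intro c; rw [smul_add, map_add, hy, hz, add_zero]
  | smul d y _ hy => intro c; rw [smul_smul]; exact hy _

/-- A left `A`-linear map `θ : B → A` induces a map `M ⊗_A B → M`; hence `m ⊗ 1 = 0` implies
`m · θ(1) = 0`. -/
theorem smul_eq_zero_of_tmul_one_eq_zero {M : GrMod 𝒜} (θ : B →ₗ[k] A)
    (hθ : ∀ c b, θ (f c * b) = c * θ b) {m : M} (hm : tmul (ℬ := ℬ) f hf M 1 m = 0) :
    op (θ 1) • m = 0 := by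
  -- The map `m ⊗ b ↦ m · θ(b)`; left `A`-linearity of `θ` makes it balanced.
  let g : B ⊗[k] M →ₗ[k] M := TensorProduct.lift
    ((Algebra.lsmul k k M.carrier).toLinearMap ∘ₗ (MulOpposite.opLinearEquiv k).toLinearMap ∘ₗ θ)
  refine map_eq_zero_of_mem_span_tensorRel (f := f) (t := (1 : B) ⊗ₜ[k] m) g.toAddMonoidHom
    (fun a b m => ?_) ((Submodule.Quotient.mk_eq_zero _).1 hm)
  change op (θ b) • op a • m = op (θ (f a * b)) • m
  rw [hθ, MulOpposite.op_mul, mul_smul]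

variable (f hf)

/-- The natural map `M → M ⊗_A B`, `m ↦ m ⊗ 1`. -/
def tensorUnit : 𝟭 (GrMod 𝒜) ⟶ tensorFunctor (ℬ := ℬ) f hf ⋙ restrict f hf where
  app M :=
    { toLin :=
        { toFun := fun m => tmul (ℬ := ℬ) f hf M 1 m
          map_add' := fun m n => map_add (tmul (ℬ := ℬ) f hf M 1) m n
          map_smul' := fun a m => by
            obtain ⟨a, rfl⟩ := MulOpposite.op_surjective a
            refine (tmul_op_smul M a 1 m).trans ?_
            rw [mul_one, ← one_mul (f a), ← tmul_smul]
            rfl }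
      map_deg := fun i m hm => by
        have := tmul_mem_deg (f := f) (hf := hf) M hm (SetLike.GradedOne.one_mem (A := ℬ))
        rwa [Nat.cast_zero, add_zero] at this }
  naturality M N φ := rfl

/-- The map `N ⊗_A B → N`, `n ⊗ b ↦ n · b`. -/
def tensorCounitLin (N : GrMod ℬ) :
    (tensorObj (ℬ := ℬ) f hf (restrictObj f hf N)).carrier →ₗ[Bᵐᵒᵖ] N.carrier :=
  Submodule.liftQ _
    (TensorProduct.AlgebraTensorModule.lift
      { toFun := fun b => (Algebra.lsmul k k N.carrier (op b) : N.carrier →ₗ[k] N.carrier)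
        map_add' := fun b c => LinearMap.ext fun n : N.carrier => add_smul (op b) (op c) n
        map_smul' := fun c b => by
          ext n
          exact mul_smul c (op b) n } :
      B ⊗[k] (restrictObj f hf N).carrier →ₗ[Bᵐᵒᵖ] N.carrier)
    (Submodule.span_le.2 (by
      rintro _ ⟨n, a, b, rfl⟩
      refine LinearMap.mem_ker.2 ((map_sub _ _ _).trans (sub_eq_zero.2 ?_))
      exact (mul_smul (op b) (op (f a)) (show N.carrier from n)).symm))

/-- The natural map `N ⊗_A B → N`, `n ⊗ b ↦ n · b`. -/
def tensorCounit : restrict f hf ⋙ tensorFunctor (ℬ := ℬ) f hf ⟶ 𝟭 (GrMod ℬ) where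
  app N :=
    { toLin := tensorCounitLin f hf N
      map_deg := by
        rintro i _ ⟨t, ht, rfl⟩
        change _ ∈ N.deg i
        refine (Submodule.span_le (p := (N.deg i).comap
          ((tensorCounitLin f hf N ∘ₗ Submodule.mkQ _).restrictScalars k))).2 ?_ ht
        rintro _ ⟨i, j, n, b, hn, hb, rfl, rfl⟩
        exact N.smul_mem hn hb }
  naturality N P φ := by
    apply Hom.ext
    apply Submodule.linearMap_qext
    apply TensorProduct.AlgebraTensorModule.ext
    intro b n
    exact (map_smul (Hom.toLin φ) (op b) (show N.carrier from n)).symm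

end Restrict
-- A criterion for extension of scalars to be an equivalence on `QGr`.
section Equivalence

variable {k : Type u} {A B : Type x} [Field k] [Ring A] [Algebra k A] [Ring B] [Algebra k B]
  {𝒜 : ℕ → Submodule k A} [GradedAlgebra 𝒜] {ℬ : ℕ → Submodule k B} [GradedAlgebra ℬ]
  {f : A →ₐ[k] B} {hf : ∀ i, ∀ a ∈ 𝒜 i, f a ∈ ℬ i}

/-- An element of `ℬ n` is a sum of products `f(a) c` with `a` of degree `n`. Once `f(a)` sends an
element into the `B`-submodule `K`, so does `f(a) c`; hence the same bound works over both algebras.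
-/
theorem eventuallyMem_restrictObj_iff
    (hgen : ∀ n, ℬ n ≤ (𝒜 n).map f.toLinearMap * ⊤) {N : GrMod ℬ}
    {K : Submodule Bᵐᵒᵖ N} {K' : Submodule Aᵐᵒᵖ (restrictObj f hf N).carrier}
    (hK : ∀ n : N, n ∈ K' ↔ n ∈ K) {n : N} :
    (restrictObj f hf N).EventuallyMem K' n ↔ N.EventuallyMem K n := by
  constructor
  · rintro ⟨d, hd⟩
    refine ⟨d, fun j hj b hb => ?_⟩
    refine Submodule.mul_induction_on (hgen j hb) ?_ fun y z hy hz => ?_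
    · rintro _ ⟨a, ha, rfl⟩ c -
      rw [MulOpposite.op_mul, mul_smul]
      exact K.smul_mem _ ((hK _).1 (hd j hj a ha))
    · rw [MulOpposite.op_add, add_smul]
      exact K.add_mem hy hz
  · rintro ⟨d, hd⟩
    exact ⟨d, fun j hj a ha => (hK _).2 (hd j hj (f a) (hf j a ha))⟩

theorem isoModFdim_restrict_map_iff (hgen : ∀ n, ℬ n ≤ (𝒜 n).map f.toLinearMap * ⊤)
    (hfinA : ∀ n, Module.Finite k (𝒜 n)) (hfinB : ∀ n, Module.Finite k (ℬ n))
    {N P : GrMod ℬ} (φ : N ⟶ P) :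
    isoModFdim 𝒜 ((restrict f hf).map φ) ↔ isoModFdim ℬ φ := by
  rw [isoModFdim_iff hfinA, isoModFdim_iff hfinB]
  refine and_congr (forall_congr' fun n => forall_congr' fun _ => ?_) (forall_congr' fun p => ?_)
  · exact eventuallyMem_restrictObj_iff (hf := hf) (K' := ⊥) hgen fun _ => Iff.rfl
  · exact eventuallyMem_restrictObj_iff (hf := hf) hgen fun _ => Iff.rfl

/-- In `N ⊗_A B`, with `N` a `B`-module, `t · f(a) = ε(t) f(a) ⊗ 1` for the natural map
`ε : N ⊗_A B → N`, if right multiplication by `f(a)` on `B` factors through `f` and a left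
`A`-linear map. -/
theorem smul_eq_tmul_tensorCounitLin {N : GrMod ℬ} {a : A} {θ : B →ₗ[k] A}
    (hθ : ∀ b, f (θ b) = b * f a)
    (t : (tensorObj (ℬ := ℬ) f hf (restrictObj f hf N)).carrier) :
    op (f a) • t = tmul (ℬ := ℬ) f hf (restrictObj f hf N) 1
      ((op (f a) • tensorCounitLin f hf N t : N.carrier)) := by
  induction t using tmul_induction with
  | h0 =>
    rw [smul_zero, map_zero, smul_zero]
    exact (map_zero (tmul (ℬ := ℬ) f hf (restrictObj f hf N) 1)).symm
  | hadd s t hs ht =>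
    rw [smul_add, hs, ht, map_add, smul_add]
    exact (map_add (tmul (ℬ := ℬ) f hf (restrictObj f hf N) 1) _ _).symm
  | h b n =>
    -- Both sides equal `n · f(θ b) ⊗ 1`: on the left `b f(a) = f(θ b)` is moved across the tensor
    -- sign, on the right it acts on `n` directly.
    have h1 : op (f a) • tensorCounitLin f hf N (tmul (ℬ := ℬ) f hf (restrictObj f hf N) b n) =
        op (f (θ b)) • (show N.carrier from n) := by
      rw [hθ, MulOpposite.op_mul, mul_smul]; rfl
    have h2 := tmul_op_smul (ℬ := ℬ) (hf := hf) (restrictObj f hf N) (θ b) 1 n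
    rw [mul_one] at h2
    rw [h1, tmul_smul, ← hθ]
    exact h2.symm

/-- The identity `(m ⊗ b) f(a) = m ⊗ f(θ b) = m θ(b) ⊗ 1`, which controls the cokernel of the unit.
-/
theorem smul_mem_range_tmul_one {M : GrMod 𝒜} {a : A} {θ : B →ₗ[k] A}
    (hθ : ∀ b, f (θ b) = b * f a) (t : (tensorObj (ℬ := ℬ) f hf M).carrier) :
    op (f a) • t ∈ LinearMap.range (tmul (ℬ := ℬ) f hf M 1) := by
  induction t using tmul_induction with
  | h0 => rw [smul_zero]; exact zero_mem _
  | hadd s t hs ht => rw [smul_add]; exact add_mem hs ht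
  | h b m =>
    refine ⟨op (θ b) • m, ?_⟩
    rw [tmul_op_smul, hθ, mul_one, tmul_smul]

/-- If, for `a` in some component `𝒜 ℓ`, right multiplication by `f(a)` factors as
`B → A → B` with a left `A`-linear first map sending `1` to `a`, then `- ⊗_A B` induces an
equivalence `QGr A ≌ QGr B`. -/
theorem exists_qGr_equivalence (hf : ∀ i, ∀ a ∈ 𝒜 i, f a ∈ ℬ i)
    (hgenA : ∀ i j, 𝒜 (i + j) ≤ 𝒜 i * 𝒜 j)
    (hgenB : ∀ n, ℬ n ≤ (𝒜 n).map f.toLinearMap * ⊤)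
    (hfinA : ∀ n, Module.Finite k (𝒜 n)) (hfinB : ∀ n, Module.Finite k (ℬ n)) (ℓ : ℕ)
    (hθ : ∀ a ∈ 𝒜 ℓ, ∃ θ : B →ₗ[k] A,
      (∀ c b, θ (f c * b) = c * θ b) ∧ θ 1 = a ∧ ∀ b, f (θ b) = b * f a) :
    ∃ Φ : QGr 𝒜 ⥤ QGr ℬ, Φ.IsEquivalence ∧
      Nonempty (toQGr 𝒜 ⋙ Φ ≅ tensorFunctor f hf ⋙ toQGr ℬ) := by
  have hη : ∀ M : GrMod 𝒜, isoModFdim 𝒜 ((tensorUnit (ℬ := ℬ) f hf).app M) := by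
    intro M
    rw [isoModFdim_iff hfinA]
    refine ⟨fun m hm => .of_smul hgenA hfinA ℓ fun a ha => ?_,
      fun t => .of_smul hgenA hfinA ℓ fun a ha => .of_mem ?_⟩
    · obtain ⟨θ, hlin, rfl, -⟩ := hθ a ha
      exact .of_mem (smul_eq_zero_of_tmul_one_eq_zero (hf := hf) θ hlin hm)
    · obtain ⟨θ, -, -, h⟩ := hθ a ha
      exact smul_mem_range_tmul_one h t
  have hε : ∀ N : GrMod ℬ, isoModFdim ℬ ((tensorCounit f hf).app N) := by
    intro N
    rw [isoModFdim_iff hfinB]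
    constructor
    · intro t ht
      refine (eventuallyMem_restrictObj_iff (hf := hf) (K' := ⊥) hgenB fun _ => Iff.rfl).1
        (.of_smul hgenA hfinA ℓ fun a ha => .of_mem ?_)
      obtain ⟨θ, -, -, h⟩ := hθ a ha
      refine (smul_eq_tmul_tensorCounitLin (hf := hf) h t).trans ?_
      rw [show tensorCounitLin f hf N t = 0 from ht, smul_zero]
      exact map_zero (tmul (ℬ := ℬ) f hf (restrictObj f hf N) 1)
    -- The counit is surjective outright: `n` is the image of `n ⊗ 1`.
    · exact fun n => .of_mem ⟨tmul (ℬ := ℬ) f hf (restrictObj f hf N) 1 n, one_smul Bᵐᵒᵖ n⟩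
  refine MorphismProperty.exists_localization_equivalence (tensorFunctor f hf) (restrict f hf)
    (fun M N φ hφ => ?_)
    (fun M N φ hφ => (isoModFdim_restrict_map_iff hgenB hfinA hfinB φ).2 hφ)
    (tensorUnit f hf) hη (tensorCounit f hf) hε
  -- Preservation by extension of scalars: after restriction to `A`, the naturality square of the
  -- unit joins `φ` to `φ ⊗ B` by unit maps already known to be in the class.
  rw [← isoModFdim_restrict_map_iff hgenB hfinA hfinB (hf := hf)]
  refine isoModFdim_of_comp_left hgenA hfinA (hη M) ?_
  have := (tensorUnit (ℬ := ℬ) f hf).naturality φ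
  rw [show (tensorUnit (ℬ := ℬ) f hf).app M ≫ (restrict f hf).map ((tensorFunctor f hf).map φ) =
    φ ≫ (tensorUnit (ℬ := ℬ) f hf).app N from this.symm]
  exact isoModFdim_comp hgenA hfinA hφ (hη N)

end Equivalence
end GrMod

/-! ### Generation and finiteness of the two graded algebras. -/

namespace MonomialAlgebra

variable {k : Type u} {G : Type v} [Field k] {F : Finset (List G)}

theorem mk_word_eq_zero {w : List G} (hw : ¬ IsLegal k F w) : mk k F (word k w) = 0 :=
  (RingCon.eq _).2 (not_not.1 hw : word k w ∈ monomialIdeal k F)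

/-- A word of length `i + j` is cut after its first `i` letters. -/
theorem grading_add_le (i j : ℕ) : grading k F (i + j) ≤ grading k F i * grading k F j := by
  refine Submodule.span_le.2 ?_
  rintro _ ⟨w, hw, rfl⟩
  rw [← List.take_append_drop i w, word_append, map_mul]
  exact Submodule.mul_mem_mul
    (Submodule.subset_span ⟨w.take i, by rw [List.length_take]; omega, rfl⟩)
    (Submodule.subset_span ⟨w.drop i, by rw [List.length_drop]; omega, rfl⟩)

theorem finite_grading [Finite G] (n : ℕ) : Module.Finite k (grading k F n) := by
  refine FiniteDimensional.span_of_finite k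
    (((List.finite_length_eq G n).image fun w => mk k F (word k w)).subset ?_)
  rintro _ ⟨w, hw, rfl⟩
  exact ⟨w, hw, rfl⟩

/-- Induction on the elements of a monomial algebra. -/
theorem induction {p : MonomialAlgebra k F → Prop} (halg : ∀ c, p (algebraMap k _ c))
    (hletter : ∀ x, p (mk k F (FreeAlgebra.ι k x))) (hmul : ∀ a b, p a → p b → p (a * b))
    (hadd : ∀ a b, p a → p b → p (a + b)) (a : MonomialAlgebra k F) : p a := by
  obtain ⟨z, rfl⟩ := mk_surjective a
  induction z using FreeAlgebra.induction with
  | grade0 c => exact halg c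
  | grade1 x => exact hletter x
  | mul y z hy hz => rw [map_mul]; exact hmul _ _ hy hz
  | add y z hy hz => rw [map_add]; exact hadd _ _ hy hz

end MonomialAlgebra

namespace PathAlgebra

variable {k : Type u} {V : Type v} [Field k] [Quiver.{v} V]

theorem finite_setOf_length_eq [Finite V] [∀ a b : V, Finite (a ⟶ b)] (n : ℕ) :
    {p : QPath V | p.2.2.length = n}.Finite := by
  induction n with
  | zero =>
    refine (Set.finite_range fun a : V => (⟨a, a, .nil⟩ : QPath V)).subset ?_
    rintro ⟨a, b, p⟩ hp
    cases p with
    | nil => exact ⟨a, rfl⟩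
    | cons p e => exact absurd hp (Nat.succ_ne_zero _)
  | succ n ih =>
    have := ih.to_subtype
    refine (Set.finite_range fun q : Σ p : {p : QPath V | p.2.2.length = n}, Σ c : V,
      (p.1.2.1 ⟶ c) => (⟨q.1.1.1, q.2.1, q.1.1.2.2.cons q.2.2⟩ : QPath V)).subset ?_
    rintro ⟨a, b, p⟩ hp
    cases p with
    | nil => exact absurd hp (Nat.succ_ne_zero _).symm
    | cons p e => exact ⟨⟨⟨⟨a, _, p⟩, Nat.succ_injective hp⟩, _, e⟩, rfl⟩

theorem finite_grading [Finite V] [∀ a b : V, Finite (a ⟶ b)] (n : ℕ) :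
    Module.Finite k (grading k V n) := by
  refine FiniteDimensional.span_of_finite k
    (((finite_setOf_length_eq n).image fun p => ofPath k p).subset ?_)
  rintro _ ⟨p, hp, rfl⟩
  exact ⟨p, hp, rfl⟩

theorem induction {p : PathAlgebra k V → Prop} (h0 : p 0) (hadd : ∀ a b, p a → p b → p (a + b))
    (hsmul : ∀ (c : k) a, p a → p (c • a)) (hpath : ∀ q, p (ofPath k q))
    (a : PathAlgebra k V) : p a := by
  refine Finsupp.induction_linear a h0 hadd fun q c => ?_
  have : (Finsupp.single q c : QPath V →₀ k) = c • ofPath k q := by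
    change _ = c • Finsupp.single q (1 : k)
    rw [Finsupp.smul_single, smul_eq_mul, mul_one]
  rw [this]
  exact hsmul c _ (hpath q)

end PathAlgebra

/-! ### Paths of the Ufnarovskii graph and their labels. -/

namespace UfnGraph

variable {k : Type u} {G : Type v} [Field k] {F : Finset (List G)}

theorem hom_ext {s t : UfnGraph k F} {a b : s ⟶ t} (h : a.1 = b.1) : a = b := Subtype.ext h

/-- The word of a path followed by its last vertex begins with its first vertex. -/
theorem exists_pathLabel_append {s t : UfnGraph k F} (p : Quiver.Path s t) :
    ∃ v, pathLabel p ++ t.1 = s.1 ++ v := by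
  induction p with
  | nil => exact ⟨[], by simp [pathLabel]⟩
  | cons p a ih =>
    obtain ⟨v, hv⟩ := ih
    obtain ⟨y, hy⟩ := a.2.2.2.1
    -- The word of the arrow `a` reads both as its label followed by its target and as its source
    -- followed by `y`.
    exact ⟨v ++ [y], by
      rw [pathLabel, List.append_assoc, List.singleton_append, ← word_eq_cons, hy,
        ← List.append_assoc, hv, List.append_assoc]⟩

/-- An arrow is determined by its target and its label. -/
theorem arrow_ext {s s' t : UfnGraph k F} (a : s ⟶ t) (b : s' ⟶ t) (h : label a = label b) :
    (⟨s, a⟩ : Σ s, s ⟶ t) = ⟨s', b⟩ := by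
  have hw : a.1 = b.1 := by rw [word_eq_cons, word_eq_cons, h]
  obtain ⟨y, hy⟩ := a.2.2.2.1
  obtain ⟨y', hy'⟩ := b.2.2.2.1
  have hs : s = s' := Subtype.ext (List.append_inj (hy.symm.trans (hw.trans hy'))
    (s.2.1.trans s'.2.1.symm)).1
  subst hs
  rw [hom_ext hw]

/-- A legal word `x t`, with `t` a vertex, is the word of an arrow. -/
theorem exists_arrow {x : G} {t : UfnGraph k F} (h : IsLegal k F (x :: t.1)) :
    ∃ (s : UfnGraph k F) (a : s ⟶ t), label a = x := by
  have hlen : (x :: t.1).length = ell F + 1 := by rw [List.length_cons, t.2.1]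
  obtain ⟨w, y, hwy⟩ : ∃ w y, x :: t.1 = w ++ [y] :=
    ⟨_, _, (List.dropLast_append_getLast (List.cons_ne_nil x t.1)).symm⟩
  have hw : w.length = ell F := by
    rw [hwy, List.length_append, List.length_singleton] at hlen
    omega
  have hl := h
  rw [hwy] at hl
  exact ⟨⟨w, hw, hl.of_append⟩, ⟨x :: t.1, hlen, h, ⟨y, hwy⟩, ⟨x, rfl⟩⟩, rfl⟩

section Finite

variable [Finite G]

open PathAlgebra

/-- The trivial path at a vertex. -/
abbrev idem (k : Type u) {G : Type v} [Field k] {F : Finset (List G)} (t : UfnGraph k F) :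
    PathAlgebra k (UfnGraph k F) := ofPath k ⟨t, t, .nil⟩

/-- By `arrow_ext`, at most one arrow labeled `x` ends at `t`, so a single summand survives. -/
theorem arrowSum_mul_ofPath (x : G) {t c : UfnGraph k F} (p : Quiver.Path t c) {s : UfnGraph k F}
    (a : s ⟶ t) (ha : label a = x) :
    arrowSum k F x * ofPath k ⟨t, c, p⟩ = ofPath k ⟨s, c, a.toPath.comp p⟩ := by
  classical
  simp only [arrowSum, Finset.sum_mul]
  rw [Finset.sum_eq_single s, Finset.sum_eq_single t, Finset.sum_eq_single a]
  · rw [if_pos ha, ofPath_mul_comp]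
  · intro b _ hb
    rw [if_neg, zero_mul]
    intro h
    exact hb (eq_of_heq (Sigma.mk.inj (arrow_ext b a (h.trans ha.symm))).2)
  · intro h; exact absurd (Finset.mem_univ _) h
  · intro t' _ ht'
    refine Finset.sum_eq_zero fun b _ => ?_
    split_ifs
    · exact ofPath_mul_ne (Ne.symm ht')
    · exact zero_mul _
  · intro h; exact absurd (Finset.mem_univ _) h
  · intro s' _ hs'
    refine Finset.sum_eq_zero fun t' _ => Finset.sum_eq_zero fun b _ => ?_
    split_ifs with h
    · by_cases ht : t = t'
      · subst ht
        exact absurd (Sigma.mk.inj (arrow_ext b a (h.trans ha.symm))).1 hs'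
      · exact ofPath_mul_ne ht
    · exact zero_mul _
  · intro h; exact absurd (Finset.mem_univ _) h

theorem arrowSum_mul_ofPath_eq_zero (x : G) (p : QPath (UfnGraph k F))
    (hx : ¬ IsLegal k F (x :: p.1.1)) : arrowSum k F x * ofPath k p = 0 := by
  classical
  simp only [arrowSum, Finset.sum_mul]
  refine Finset.sum_eq_zero fun s _ => Finset.sum_eq_zero fun t _ =>
    Finset.sum_eq_zero fun a _ => ?_
  split_ifs with h
  · refine ofPath_mul_ne fun ht => hx ?_
    rw [ht, ← h]
    exact word_eq_cons a ▸ a.2.2.1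
  · exact zero_mul _

theorem hom_letter (x : G) : hom k F (MonomialAlgebra.mk k F (FreeAlgebra.ι k x)) =
    arrowSum k F x :=
  FreeAlgebra.lift_ι_apply _ _

/-- A path is determined by its label and its last vertex. -/
theorem hom_pathLabel_mul {s t : UfnGraph k F} (p : Quiver.Path s t) :
    hom k F (MonomialAlgebra.mk k F (word k (pathLabel p))) * idem k t = ofPath k ⟨s, t, p⟩ := by
  induction p with
  | nil => rw [pathLabel, word_nil, map_one, map_one, one_mul]
  | @cons b c p a ih =>
    rw [pathLabel, word_append, word_cons, word_nil, mul_one, map_mul, map_mul, hom_letter,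
      mul_assoc, arrowSum_mul_ofPath _ _ a rfl, Quiver.Path.comp_nil]
    -- Inserting the trivial path at `b` makes the induction hypothesis for `p` applicable.
    have : ofPath k ⟨b, c, a.toPath⟩ = idem k b * ofPath k ⟨b, c, a.toPath⟩ := by
      rw [ofPath_mul_comp, Quiver.Path.nil_comp]
    rw [this, ← mul_assoc, ih, ofPath_mul_comp]
    rfl

/-- A path whose label has length `ℓ` starts at the vertex given by that label. Hence every path in
the image of `w` starts at `w`. -/
theorem idem_mul_hom_word {w : List G} (hw : w.length = ell F) (t : UfnGraph k F) :
    (w = t.1 → idem k t * hom k F (MonomialAlgebra.mk k F (word k w)) =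
      hom k F (MonomialAlgebra.mk k F (word k w))) ∧
    (w ≠ t.1 → idem k t * hom k F (MonomialAlgebra.mk k F (word k w)) = 0) := by
  have hmem := freeHom_word (k := k) (F := F) w
  change hom k F (MonomialAlgebra.mk k F (word k w)) ∈ _ at hmem
  generalize hom k F (MonomialAlgebra.mk k F (word k w)) = z at hmem
  induction hmem using Submodule.span_induction with
  | mem z hz =>
    obtain ⟨⟨s, c, p⟩, hp, rfl⟩ := hz
    obtain ⟨v, hv⟩ := exists_pathLabel_append p
    have hs : w = s.1 := by
      rw [← hp]
      exact (List.append_inj hv (by rw [hp, hw, s.2.1])).1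
    constructor
    · intro ht
      obtain rfl : s = t := Subtype.ext (hs.symm.trans ht)
      rw [ofPath_mul_comp, Quiver.Path.nil_comp]
    · intro ht
      refine ofPath_mul_ne fun h => ht ?_
      rw [hs]
      exact congrArg Subtype.val h
  | zero => simp
  | add y z _ _ hy hz =>
    exact ⟨fun h => by rw [mul_add, hy.1 h, hz.1 h],
      fun h => by rw [mul_add, hy.2 h, hz.2 h, add_zero]⟩
  | smul c y _ hy =>
    exact ⟨fun h => by rw [mul_smul_comm, hy.1 h], fun h => by rw [mul_smul_comm, hy.2 h, smul_zero]⟩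

/-! ### Factorization of right multiplication by elements of degree `ℓ`. -/

open Classical in
/-- The map `kQ → A` which sends a path with label `w` to the word `w u` if its last vertex is `u`,
and to zero otherwise. -/
def appendWord (k : Type u) {G : Type v} [Field k] [Finite G] (F : Finset (List G)) (u : List G) :
    PathAlgebra k (UfnGraph k F) →ₗ[k] MonomialAlgebra k F :=
  liftPath fun p =>
    if p.2.1.1 = u then MonomialAlgebra.mk k F (word k (pathLabel p.2.2 ++ u)) else 0

open Classical in
theorem appendWord_ofPath (u : List G) (p : QPath (UfnGraph k F)) :
    appendWord k F u (ofPath k p) =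
      if p.2.1.1 = u then MonomialAlgebra.mk k F (word k (pathLabel p.2.2 ++ u)) else 0 :=
  liftPath_ofPath _ p

-- The `A`-linearity of `appendWord` on letters. If `x` followed by the first vertex is legal, the
-- path is prolonged by the unique arrow labeled `x`; otherwise the left side is zero, and so is the
-- right.
open Classical in
theorem appendWord_arrowSum_mul (u : List G) (x : G) (b : PathAlgebra k (UfnGraph k F)) :
    appendWord k F u (arrowSum k F x * b) =
      MonomialAlgebra.mk k F (FreeAlgebra.ι k x) * appendWord k F u b := by
  induction b using PathAlgebra.induction with
  | h0 => rw [mul_zero, map_zero, mul_zero]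
  | hadd b c hb hc => rw [mul_add, map_add, hb, hc, map_add, mul_add]
  | hsmul c b hb => rw [mul_smul_comm, map_smul, hb, map_smul, mul_smul_comm]
  | hpath q =>
    obtain ⟨t, c, p⟩ := q
    by_cases h : IsLegal k F (x :: t.1)
    · obtain ⟨s, a, rfl⟩ := exists_arrow h
      rw [arrowSum_mul_ofPath _ p a rfl, appendWord_ofPath, appendWord_ofPath]
      change (if c.1 = u then _ else _) = _ * (if c.1 = u then _ else _)
      split_ifs
      · rw [pathLabel_comp, ← map_mul, ← word_cons]
        rfl
      · rw [mul_zero]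
    · rw [arrowSum_mul_ofPath_eq_zero _ _ h, map_zero, appendWord_ofPath]
      split_ifs with hu
      -- The label of `p` followed by `u` begins with the first vertex `t`, so prefixing `x` gives a
      -- word beginning with the illegal word `x t`.
      · obtain ⟨v, hv⟩ := exists_pathLabel_append p
        rw [← map_mul, ← word_cons, MonomialAlgebra.mk_word_eq_zero]
        intro hl
        rw [← hu, hv, ← List.cons_append] at hl
        exact h hl.of_append
      · rw [mul_zero]

theorem appendWord_hom_mul (u : List G) (c : MonomialAlgebra k F)
    (b : PathAlgebra k (UfnGraph k F)) :
    appendWord k F u (hom k F c * b) = c * appendWord k F u b := by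
  induction c using MonomialAlgebra.induction generalizing b with
  | halg c =>
    rw [AlgHom.commutes, ← Algebra.smul_def, map_smul, Algebra.smul_def]
  | hletter x => rw [hom_letter, appendWord_arrowSum_mul]
  | hmul a a' ha ha' => rw [map_mul (hom k F), mul_assoc, ha, ha', mul_assoc]
  | hadd a a' ha ha' => rw [map_add (hom k F), add_mul, map_add, ha, ha', add_mul]

/-- Among the trivial paths that sum to `1`, only the one at `u` contributes. If `u` is illegal it
is not a vertex, and both sides vanish. -/
theorem appendWord_one {u : List G} (hu : u.length = ell F) :
    appendWord k F u 1 = MonomialAlgebra.mk k F (word k u) := by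
  rw [one_def, map_sum]
  by_cases h : IsLegal k F u
  · refine (Finset.sum_eq_single (⟨u, hu, h⟩ : UfnGraph k F) ?_ ?_).trans ?_
    · intro t _ ht
      rw [appendWord_ofPath]
      exact if_neg fun h => ht (Subtype.ext h)
    · exact fun h => (h (@Finset.mem_univ (UfnGraph k F) _ _)).elim
    · rw [appendWord_ofPath]
      exact if_pos rfl
  · rw [MonomialAlgebra.mk_word_eq_zero h]
    refine Finset.sum_eq_zero fun t _ => ?_
    rw [appendWord_ofPath]
    exact if_neg fun ht : t.1 = u => h (ht ▸ t.2.2)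

/-- With `p = f(w) e_t`, the product `p f(u)` is `f(w) (e_t f(u))`, which is `f(wu)` or zero
according to whether `t = u`. -/
theorem hom_appendWord {u : List G} (hu : u.length = ell F) (b : PathAlgebra k (UfnGraph k F)) :
    hom k F (appendWord k F u b) = b * hom k F (MonomialAlgebra.mk k F (word k u)) := by
  induction b using PathAlgebra.induction with
  | h0 => rw [map_zero, map_zero, zero_mul]
  | hadd b c hb hc => rw [map_add, map_add, hb, hc, add_mul]
  | hsmul c b hb => rw [map_smul, map_smul, hb, smul_mul_assoc]
  | hpath q =>
    obtain ⟨s, t, p⟩ := q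
    rw [appendWord_ofPath, ← hom_pathLabel_mul p, mul_assoc]
    split_ifs with h
    · rw [(idem_mul_hom_word hu t).1 (Eq.symm h), word_append, map_mul, map_mul]
    · rw [(idem_mul_hom_word hu t).2 (Ne.symm h), mul_zero, map_zero]

/-- The three conditions on `θ` are compatible with sums and scalar multiples of pairs `(θ, a)`, so
words of length `ℓ` suffice, and for these `appendWord` is the required map. -/
theorem exists_factorization (a : MonomialAlgebra k F)
    (ha : a ∈ MonomialAlgebra.grading k F (ell F)) :
    ∃ θ : PathAlgebra k (UfnGraph k F) →ₗ[k] MonomialAlgebra k F,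
      (∀ c b, θ (hom k F c * b) = c * θ b) ∧ θ 1 = a ∧ ∀ b, hom k F (θ b) = b * hom k F a := by
  induction ha using Submodule.span_induction with
  | mem a ha =>
    obtain ⟨u, hu, rfl⟩ := ha
    exact ⟨appendWord k F u, appendWord_hom_mul u, appendWord_one hu, hom_appendWord hu⟩
  | zero => exact ⟨0, by simp⟩
  | add a a' _ _ ha ha' =>
    obtain ⟨θ, h1, h2, h3⟩ := ha
    obtain ⟨θ', h1', h2', h3'⟩ := ha'
    exact ⟨θ + θ', by simp [h1, h1', mul_add], by simp [h2, h2'], by simp [h3, h3', mul_add]⟩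
  | smul c a _ ha =>
    obtain ⟨θ, h1, h2, h3⟩ := ha
    exact ⟨c • θ, by simp [h1], by simp [h2], by simp [h3]⟩

/-- A path is the image of its label times the trivial path at its end, and the label has the length
of the path. -/
theorem grading_le_map_mul_top (n : ℕ) : PathAlgebra.grading k (UfnGraph k F) n ≤
    (MonomialAlgebra.grading k F n).map (hom k F).toLinearMap * ⊤ := by
  refine Submodule.span_le.2 ?_
  rintro _ ⟨⟨s, t, p⟩, rfl, rfl⟩
  rw [← hom_pathLabel_mul p]
  exact Submodule.mul_mem_mul ⟨_, pathLabel_length p ▸ MonomialAlgebra.word_mem_grading _, rfl⟩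
    trivial

end Finite
end UfnGraph
end

theorem mainTheorem2 (k : Type u) [Field k] (G : Type v) [Finite G] (F : Finset (List G))
    (hF : [] ∉ F) :
    ∃ Φ : GrMod.QGr (MonomialAlgebra.grading k F) ⥤
        GrMod.QGr (PathAlgebra.grading k (UfnGraph k F)),
      Φ.IsEquivalence ∧
      Nonempty (GrMod.toQGr (MonomialAlgebra.grading k F) ⋙ Φ ≅
        GrMod.tensorFunctor (ℬ := PathAlgebra.grading k (UfnGraph k F))
            (UfnGraph.hom k F) UfnGraph.hom_mem_grading ⋙
          GrMod.toQGr (PathAlgebra.grading k (UfnGraph k F))) := by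
  exact GrMod.exists_qGr_equivalence UfnGraph.hom_mem_grading MonomialAlgebra.grading_add_le
    UfnGraph.grading_le_map_mul_top MonomialAlgebra.finite_grading PathAlgebra.finite_grading
    (ell F) UfnGraph.exists_factorization
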